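/- **Notation.** Let $H$ be a finite abelian group. Write $[\![k]\!]=\{0,1\}^k$, with the order $\omega\subseteq\eta$ iff $\omega_i\le\eta_i$ for all $i$, and $|\omega|=\sum_i\omega_i$; for $\omega_i=1$ let $\omega\setminus\{i\}$ be $\omega$ with $i$-th coordinate replaced by $0$. A $k$-cube is a map $\angle(x;h_1,\dots,h_k)\colon[\![k]\!]\to H$, $\omega\mapsto x+\sum_{i:\omega_i=1}h_i$; the set of $k$-cubes is $C^k(H)$. For $f$ from $H$ to an abelian group, $\partial^kf(c)=\sum_{\omega\in[\![k]\!]}(-1)^{|\omega|}f(c(\omega))$. A face is a set $F=\{\omega:\eta_0\subseteq\omega\subseteq\eta_1\}$ with $\eta_0\subseteq\eta_1$, of dimension $m=|\eta_1|-|\eta_0|$ and codimension $k-m$; $c|_F$ is the restriction of $c$ to $F$, with $F$ identified with $[\![m]\!]$ through its non-constant coordinates in increasing order. A *system of cubes with parameter $\delta'>0$* is a collection of sets $S_j\subseteq C^j(H)$, $0\le j\le k$, such that (1) each $S_j$ is closed under permutations and reflections of the coordinates of $[\![j]\!]$; (2) if $1\le j\le k$, $c\in S_j$ and $F$ is a face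 of $[\![j]\!]$ of dimension $m$ then $c|_F\in S_m$; (3) for $0\le j<k$ and $c\in S_j$ there are at least $\delta'|H|$ elements $h\in H$ such that the $(j+1)$-cube equal to $c$ on the face $\{\omega_{j+1}=0\}$ and to $c+h$ on the face $\{\omega_{j+1}=1\}$ lies in $S_{j+1}$. For $1\le i\le k$ let $T_{k,i}$ be the set of triples $(c_0,c_1,c)$ with $c=\angle(x;h_1,\dots,h_i,\dots,h_k)$, $c_0=\angle(x;h_1,\dots,h_i+h_i',\dots,h_k)$, $c_1=\angle(x+h_i;h_1,\dots,h_i',\dots,h_k)$, where $x,h_1,\dots,h_k,h_i'\in H$. For $0\le r\le k-1$ put $$Z_r(\omega,\omega')=\sum_{\eta:\ \omega\supseteq\eta\supseteq\omega',\ |\eta|\le r}(-1)^{|\omega|-|\eta|},$$ and define the normal form of $\tau\colon[\![k]\!]\to A$ ($A$ an abelian group) as $\tau'(\omega')=\sum_{\omega}Z_r(\omega,\omega')\tau(\omega)$. A function $\rho\colon S_k\times[\![k]\!]\to\mathbb Z^d$ is a *generalized $k$-cocycle of type $r$ and loss $\delta>0$* on $S_k$ if * $\rho(c,\omega)=0$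 whenever $|\omega|\ge r+1$; * for every $\omega$ and every $i$ with $\omega_i=1$, at most $\delta|H|^{k+2}$ triples $(c_0,c_1,c)\in T_{k,i}$ satisfy $c_0,c_1\in S_k$ and $\rho(c_0,\omega)\ne\rho(c_1,\omega)$; * for every $i$, at most $\delta|H|^{k+2}$ of the triples $(c_0,c_1,c)\in T_{k,i}$ with $c_0,c_1,c\in S_k$ fail to satisfy $$\rho(c,\omega)=\sum_{\omega'\in[\![k]\!]}Z_r(\omega',\omega)\,\mathfrak b(\omega')\quad\text{for all }\omega\in[\![k]\!],$$ where $\mathfrak b(\omega')=\rho(c_0,\omega')$ if $\omega'_i=0$ and $\mathfrak b(\omega')=\rho(c_1,\omega'\setminus\{i\})$ if $\omega'_i=1$. A function from $H$ to an abelian group $A$ is a *polynomial map of degree $s$* if, for every $n\ge0$, composition with it sends the Host–Kra group $\mathrm{HK}^n$ of $H$, filtered by $H=H_0=H_1$, $H_i=0$ for $i\ge2$, into the Host–Kra group $\mathrm{HK}^n$ of $A$, filtered by $A=A_0=\dots=A_s$, $A_i=0$ for $i>s$. Here $\mathrm{HK}^n(G_\bullet)\le G^{[\![n]\!]}$ is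 generated by the configurations equal to $g$ on $F$ and to $0$ off $F$, where $g\in G_i$ and $F$ is a face of codimension at most $i$. **Lemma 3.5.** For every $k$ there are constants $\varepsilon_0,A,B,K>0$ depending only on $k$ such that the following holds for every finite abelian group $H$ and all integers $d\ge0$ and $0\le r\le k-1$. Let $S_0,\dots,S_k$ be a system of cubes in $H$ with parameter $1-\varepsilon$, where $\varepsilon\le\varepsilon_0$, and let $\rho\colon S_k\times[\![k]\!]\to\mathbb Z^d$ be a generalized $k$-cocycle of type $r$ and loss at most $\delta$ on $S_k$, where $\delta>0$. Then there is a function $\lambda\colon H\to\mathbb R^d$ such that, writing $$\Lambda(c,\omega')=\sum_{\omega\in[\![k]\!]}Z_r(\omega,\omega')\,\lambda(c(\omega))$$ for the normal form of $\omega\mapsto\lambda(c(\omega))$: 1. at most $A\,\delta^{1/B}\,|C^k(H)|$ cubes $c\in S_k$ fail to satisfy $\Lambda(c,\omega)=\rho(c,\omega)$ for all $\omega\in[\![k]\!]$; 2. $\partial^{k-r}\lambda(c)\in\mathbb Z^d$ for every $c\in C^{k-r}(H)$, and (equivalently) $\lambda\bmod\mathbb Z^d\colon H\to\mathbb R^d/\mathbb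 Z^d$ is a polynomial map of degree $k-r-1$; 3. $\sup_{x\in H}\|\lambda(x)\|_1\le K\big(\sup_{c\in S_k}\|\rho(c)\|_1+d\big)$, where $\|\rho(c)\|_1=\sum_{\omega\in[\![k]\!]}\|\rho(c,\omega)\|_1$ and the supremum over an empty set is $0$. -/

import Mathlib

namespace CubeSystems

/-- The discrete cube `{0,1}^k`. Its pointwise order is inclusion of supports. -/
abbrev DCube (k : ℕ) : Type := Fin k → Bool

/-- `|ω|`, the number of coordinates equal to `1`. -/
def wt {k : ℕ} (ω : DCube k) : ℕ := (Finset.univ.filter (fun i => ω i = true)).card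

instance {k : ℕ} (ω η : DCube k) : Decidable (ω ≤ η) :=
  inferInstanceAs (Decidable (∀ i, ω i ≤ η i))

section Cubes

variable {H : Type*} [AddCommGroup H]

/-- The parallelepiped `∠(x; h_1, …, h_k)`, i.e. `ω ↦ x + ω · h`. -/
def cube {k : ℕ} (x : H) (h : Fin k → H) : DCube k → H :=
  fun ω => x + ∑ i, if ω i = true then h i else 0

/-- `C^k(H)`, the set of `k`-cubes in `H`. -/
def cubes (k : ℕ) (H : Type*) [AddCommGroup H] : Set (DCube k → H) :=
  {c | ∃ (x : H) (h : Fin k → H), c = cube x h}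

/-- The iterated derivative `∂^k f(c) = ∑_ω (-1)^{|ω|} f(c(ω))`. -/
def cubeDeriv {X A : Type*} [AddCommGroup A] {k : ℕ} (f : X → A) (c : DCube k → X) : A :=
  ∑ ω : DCube k, ((-1 : ℤ) ^ wt ω) • f (c ω)

/-- The parametrisation `{0,1}^m → {0,1}^k` of an `m`-dimensional face. The active coordinates of
the face, in increasing order, are the values of `e`; the other coordinates are frozen to their
values in `η` (the values of `η` at the active coordinates are irrelevant). -/
noncomputable def faceMap {m k : ℕ} (e : Fin m ↪o Fin k) (η : DCube k) (ω : DCube m) : DCube k :=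
  Function.extend e ω η

/-- `[c, c']_{k+1}`: the configuration `c` on the face where the last coordinate is `0`, and `c'`
on the face where the last coordinate is `1`. -/
def joinLast {X : Type*} {k : ℕ} (c c' : DCube k → X) : DCube (k + 1) → X :=
  fun ω => if ω (Fin.last k) = true then c' (Fin.init ω) else c (Fin.init ω)

/-- `S_0, …, S_n` is a system of cubes in `H` with parameter `δ > 0`. In terms of the degree `s` of
the system, `n = s + 1`. The sets `S j` with `j > n` play no role. -/
structure IsCubeSystem (n : ℕ) (δ : ℝ) (S : (j : ℕ) → Set (DCube j → H)) : Prop where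
  param_pos : 0 < δ
  subset_cubes : ∀ j ≤ n, S j ⊆ cubes j H
  /-- closure under coordinate permutations -/
  perm : ∀ j ≤ n, ∀ c ∈ S j, ∀ σ : Equiv.Perm (Fin j), (fun ω : DCube j => c (ω ∘ σ)) ∈ S j
  /-- closure under coordinate reflections -/
  reflect : ∀ j ≤ n, ∀ c ∈ S j, ∀ i : Fin j,
    (fun ω : DCube j => c (Function.update ω i (!(ω i)))) ∈ S j
  /-- closure under restriction to faces -/
  face : ∀ j, 1 ≤ j → j ≤ n → ∀ c ∈ S j, ∀ (m : ℕ) (e : Fin m ↪o Fin j) (η : DCube j),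
    (fun ω : DCube m => c (faceMap e η ω)) ∈ S m
  /-- popularity -/
  popular : ∀ j < n, ∀ c ∈ S j,
    δ * (Nat.card H : ℝ) ≤ (({h : H | joinLast c (fun ω => c ω + h) ∈ S (j + 1)}.ncard : ℕ) : ℝ)

/-- `T_{k,i}`: the triples `(c₀, c₁, c)` of `k`-cubes such that `c₀` and `c₁` share their upper face
in direction `i`, and `c` is obtained by glueing `c₀` and `c₁` along that face. -/
def gluedTriples (H : Type*) [AddCommGroup H] (k : ℕ) (i : Fin k) :
    Set ((DCube k → H) × (DCube k → H) × (DCube k → H)) :=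
  {t | ∃ (x : H) (h : Fin k → H) (h' : H),
    t.2.2 = cube x h ∧
    t.1 = cube x (Function.update h i (h i + h')) ∧
    t.2.1 = cube (x + h i) (Function.update h i h')}

end Cubes

/-- The coefficient `Z_r(ω, ω') = ∑ (-1)^{|ω| - |η|}` over all `η` with `ω ⊇ η ⊇ ω'`, `|η| ≤ r`. -/
def zCoeff {k : ℕ} (r : ℕ) (ω ω' : DCube k) : ℤ :=
  ∑ η ∈ Finset.univ.filter (fun η : DCube k => ω' ≤ η ∧ η ≤ ω ∧ wt η ≤ r),
    (-1 : ℤ) ^ (wt ω - wt η)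

/-- The normal form `τ'(ω') = ∑_ω Z_r(ω, ω') τ(ω)` of a configuration `τ`. -/
def normalForm {A : Type*} [AddCommGroup A] {k : ℕ} (r : ℕ) (τ : DCube k → A) : DCube k → A :=
  fun ω' => ∑ ω : DCube k, zCoeff r ω ω' • τ ω

/-- The configuration equal to `β₀(ω)` if `ω(i) = 0`, and to `β₁(ω ∖ {i})` if `ω(i) = 1`. -/
def glueConfig {A : Type*} {k : ℕ} (i : Fin k) (β₀ β₁ : DCube k → A) : DCube k → A :=
  fun ω => if ω i = true then β₁ (Function.update ω i false) else β₀ ω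

/-- `b` is `δ`-almost upper compatible on `S`. Only the values `b c ω` with `c ∈ S` matter. -/
def AlmostUpperCompatible {H : Type*} [AddCommGroup H] {d k : ℕ} (δ : ℝ)
    (S : Set (DCube k → H)) (b : (DCube k → H) → DCube k → (Fin d → ℤ)) : Prop :=
  ∀ (ω : DCube k) (i : Fin k), ω i = true →
    (({t ∈ gluedTriples H k i | t.1 ∈ S ∧ t.2.1 ∈ S ∧ b t.1 ω ≠ b t.2.1 ω}.ncard : ℕ) : ℝ)
      ≤ δ * (Nat.card H : ℝ) ^ (k + 2)

/-- `b` is a generalized `k`-cocycle of type `r` and loss `δ` on `S`.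
Only the values `b c ω` with `c ∈ S` matter. -/
structure IsGenCocycle {H : Type*} [AddCommGroup H] {d k : ℕ} (r : ℕ) (δ : ℝ)
    (S : Set (DCube k → H)) (b : (DCube k → H) → DCube k → (Fin d → ℤ)) : Prop where
  /-- `b` is in normal form -/
  normal : ∀ c ∈ S, ∀ ω : DCube k, r + 1 ≤ wt ω → b c ω = 0
  upper : AlmostUpperCompatible δ S b
  glue : ∀ i : Fin k,
    (({t ∈ gluedTriples H k i | t.1 ∈ S ∧ t.2.1 ∈ S ∧ t.2.2 ∈ S ∧
        ¬ ∀ ω : DCube k, b t.2.2 ω = normalForm r (glueConfig i (b t.1) (b t.2.1)) ω}.ncard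
          : ℕ) : ℝ)
      ≤ δ * (Nat.card H : ℝ) ^ (k + 2)

section PolynomialMaps

/-- The standard degree `s` filtration `A = A_0 = ⋯ = A_s`, `A_i = 0` for `i > s`, of an abelian
group. For `s = 1` this is the standard filtration. -/
def stdFiltration (A : Type*) [AddCommGroup A] (s : ℕ) (i : ℕ) : AddSubgroup A :=
  if i ≤ s then ⊤ else ⊥

/-- The Host–Kra cube group of an abelian group with filtration `G`: it is generated by the
configurations equal to `g` on a face `{ω : η₀ ⊆ ω ⊆ η₁}` and to `0` elsewhere, where `g ∈ G_i` and
the face has codimension `n - (|η₁| - |η₀|) ≤ i`. -/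
def hostKra {A : Type*} [AddCommGroup A] (G : ℕ → AddSubgroup A) (n : ℕ) :
    AddSubgroup (DCube n → A) :=
  AddSubgroup.closure {f | ∃ (i : ℕ) (g : A) (η₀ η₁ : DCube n), g ∈ G i ∧ η₀ ≤ η₁ ∧
    n + wt η₀ ≤ i + wt η₁ ∧ f = fun ω => if η₀ ≤ ω ∧ ω ≤ η₁ then g else 0}

/-- `p : H → A` is a polynomial map of degree `s`: it sends Host–Kra cubes of `H` (with the standard
filtration) to Host–Kra cubes of `A` (with the standard degree `s` filtration). This is used for
finite, hence discrete, `H` only, so that no continuity needs to be required. -/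
def IsPolyMap {H A : Type*} [AddCommGroup H] [AddCommGroup A] (s : ℕ) (p : H → A) : Prop :=
  ∀ (n : ℕ) (c : DCube n → H), c ∈ hostKra (stdFiltration H 1) n →
    (fun ω => p (c ω)) ∈ hostKra (stdFiltration A s) n

end PolynomialMaps

end CubeSystems

open CubeSystems

/-!
The function `lam` is obtained as an average of an exact cocycle that agrees with `ρ` on almost all
of its domain. The argument has four parts.

*Passing to ordinary cocycles.* By Möbius inversion a configuration is determined by its derivatives
on the upper faces `{ω : s ⊆ ω}`, and the normal form of type `r` discards those with `|s| > r`
(`normalForm_ind`). In terms of these derivatives, the axioms of a generalized cocycle say that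
for `|s| = r` the values over `s` are additive under glueing in the directions outside `s` and do
not depend on the directions in `s` (`IsGenCocycle.isPartialCocycle`), and that the values over `s`
are derivatives of those over `insert i s` (`IsGenCocycle.prob_mismatch_le_insert`).

*One upper face.* Let `σ` be a partial cocycle on a set of cubes of density `1 - O(ε)`. Splitting
each coordinate at a random point writes a cube as the alternating sum of its corners, the cubes
from its vertices to a common opposite vertex (`IsPartialCocycle.exists_decomposition`). As the loss
`δ` may be far smaller than `ε`, the failures are split into those where a cube leaves the domain,
which are rare at every cube of the domain, and those where a relation fails, of total proportion
`O(δ)`. The decomposition prescribes the increments `σ(x; h') - σ(x; h)` in terms of cubes that do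
not have `x` as their base; so they can be integrated at every point `x`
(`exists_increments`), even where `σ` is not defined. The sums over corners of the resulting
function are mostly independent of the opposite vertex, and their popular values are an exact
integral cocycle on all cubes (`exists_exact_of_increments`), by the identity `altSum_corners`, in
which everything cancels in pairs. An exact cocycle is the derivative of its average over all cubes
at a point (`exists_potential_of_exact`).

*All upper faces.* The potentials found for two sets of size `r` have almost everywhere the same
derivative of order `k`. A torsion-free valued function on a finite group whose derivative vanishes
almost everywhere is almost constant (`exists_eq_const_of_prob_altSum_ne_zero`), so that the
potentials may be interchanged (`IsGenCocycle.prob_mismatch_le_of_potentials`). Thus one potential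
serves all faces of dimension `k - r`, and by descent all larger ones.

*Polynomiality.* The vanishing of the derivatives of order `k - r` modulo `1` puts the compositions
with cubes into the Host–Kra group, by an expansion in indicators of upper faces
(`isPolyMap_of_altSum_eq_zero`).

The number of exceptional cubes is linear in `δ`, so the exponent `1 / B` is `1`.
-/

namespace CubeSystems

/-! ### Uniform probability on finite types -/

open Classical in
/-- The proportion of the elements of a finite type that satisfy `p`. -/
noncomputable def prob {Ω : Type*} [Fintype Ω] (p : Ω → Prop) : ℝ :=
  (∑ a, if p a then (1 : ℝ) else 0) / Fintype.card Ω

section Prob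

variable {Ω Ω' : Type*} [Fintype Ω] [Fintype Ω']

theorem prob_nonneg (p : Ω → Prop) : 0 ≤ prob p := by
  unfold prob; positivity

theorem prob_mono {p q : Ω → Prop} (h : ∀ a, p a → q a) : prob p ≤ prob q := by
  classical
  unfold prob
  gcongr with a
  by_cases hp : p a
  · simp [hp, h a hp]
  · simp only [hp, if_false]; split_ifs <;> norm_num

theorem prob_or_le (p q : Ω → Prop) : prob (fun a => p a ∨ q a) ≤ prob p + prob q := by
  classical
  unfold prob
  rw [← add_div, ← Finset.sum_add_distrib]
  gcongr with a
  by_cases hp : p a <;> by_cases hq : q a <;> simp [hp, hq]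

theorem prob_false : prob (fun _ : Ω => False) = 0 := by
  simp [prob]

theorem prob_exists_le {I : Type*} (s : Finset I) (p : I → Ω → Prop) :
    prob (fun a => ∃ i ∈ s, p i a) ≤ ∑ i ∈ s, prob (p i) := by
  classical
  induction s using Finset.induction_on with
  | empty => simp [prob_false]
  | insert i s hi ih =>
    rw [Finset.sum_insert hi]
    refine le_trans (prob_mono ?_) ((prob_or_le (p i) (fun a => ∃ i ∈ s, p i a)).trans
      (by gcongr))
    rintro a ⟨j, hj, hp⟩
    rcases Finset.mem_insert.1 hj with rfl | hj
    · exact Or.inl hp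
    · exact Or.inr ⟨j, hj, hp⟩

/-- Union bound over the subsets of a finite set. -/
theorem prob_exists_subset_le {ι : Type*} [Fintype ι] (s : Finset ι) (p : Finset ι → Ω → Prop)
    {c : ℝ} (hc : ∀ t ⊆ s, prob (p t) ≤ c) (hc0 : 0 ≤ c) :
    prob (fun a => ∃ t ∈ s.powerset, p t a) ≤ 2 ^ Fintype.card ι * c := by
  calc prob (fun a => ∃ t ∈ s.powerset, p t a) ≤ ∑ t ∈ s.powerset, prob (p t) :=
        prob_exists_le _ _
    _ ≤ ∑ t ∈ s.powerset, c := Finset.sum_le_sum fun t ht => hc t (Finset.mem_powerset.1 ht)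
    _ = 2 ^ s.card * c := by simp [Finset.card_powerset]
    _ ≤ 2 ^ Fintype.card ι * c := by
        gcongr
        · norm_num
        · exact Finset.card_le_univ s

theorem exists_not_of_prob_lt_one [Nonempty Ω] {p : Ω → Prop} (h : prob p < 1) : ∃ a, ¬ p a := by
  by_contra! hp
  have : prob p = 1 := by
    simp [prob, hp]
  linarith

theorem prob_prod (p : Ω × Ω' → Prop) :
    prob p = (∑ a, prob (fun b => p (a, b))) / Fintype.card Ω := by
  classical
  unfold prob
  rw [Fintype.sum_prod_type, Fintype.card_prod, ← Finset.sum_div, div_div, Nat.cast_mul, mul_comm]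

theorem prob_prod_le [Nonempty Ω] {p : Ω × Ω' → Prop} {c : ℝ}
    (h : ∀ a, prob (fun b => p (a, b)) ≤ c) : prob p ≤ c := by
  rw [prob_prod, div_le_iff₀ (by positivity)]
  calc _ ≤ ∑ _a : Ω, c := Finset.sum_le_sum fun a _ => h a
    _ = _ := by simp [mul_comm]

theorem exists_prob_section_le [Nonempty Ω] (p : Ω × Ω' → Prop) :
    ∃ a, prob (fun b => p (a, b)) ≤ prob p := by
  by_contra! h
  have : ∑ _a : Ω, prob p < ∑ a, prob (fun b => p (a, b)) :=
    Finset.sum_lt_sum_of_nonempty Finset.univ_nonempty fun a _ => h a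
  have h2 := prob_prod p
  rw [eq_div_iff (by positivity)] at h2
  simp only [Finset.sum_const, Finset.card_univ, nsmul_eq_mul] at this
  linarith

/-- Markov's inequality for the sections of an event. -/
theorem mul_prob_section_le (p : Ω × Ω' → Prop) (c : ℝ) :
    c * prob (fun a => c ≤ prob (fun b => p (a, b))) ≤ prob p := by
  classical
  rw [prob_prod p]
  rw [prob, mul_div_assoc', Finset.mul_sum]
  gcongr with a
  split_ifs with h
  · simpa using h
  · simpa using prob_nonneg _

theorem prob_comp_equiv (e : Ω ≃ Ω') (p : Ω' → Prop) : prob (fun a => p (e a)) = prob p := by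
  classical
  unfold prob
  rw [Fintype.card_congr e]
  congr 1
  exact e.sum_comp (fun b => if p b then (1 : ℝ) else 0)

/-- A surjective affine map between finite abelian groups preserves the uniform measure. -/
theorem prob_comp_affine {G G' : Type*} [AddCommGroup G] [AddCommGroup G'] [Fintype G]
    [Fintype G'] (f : G → G') (hf : ∀ a b c, f (a - b + c) = f a - f b + f c)
    (hs : Function.Surjective f) (p : G' → Prop) : prob (fun a => p (f a)) = prob p := by
  classical
  have key : ∀ y : G', (Finset.univ.filter fun x => f x = y).card =
      (Finset.univ.filter fun x => f x = f 0).card := by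
    intro y
    obtain ⟨x₀, rfl⟩ := hs y
    refine Finset.card_bij (fun x _ => x - x₀) ?_ ?_ ?_
    · intro x hx
      simp only [Finset.mem_filter, Finset.mem_univ, true_and] at hx ⊢
      have := hf x x₀ 0
      simp_all
    · intro a _ b _ h
      simpa using h
    · intro b hb
      simp only [Finset.mem_filter, Finset.mem_univ, true_and] at hb
      refine ⟨b + x₀, ?_, by simp⟩
      simp only [Finset.mem_filter, Finset.mem_univ, true_and]
      have := hf b 0 x₀
      simp_all
  set n := (Finset.univ.filter fun x => f x = f 0).card with hn
  have hcard : (Fintype.card G : ℝ) = n * Fintype.card G' := by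
    have := Finset.card_eq_sum_card_fiberwise (f := f) (s := Finset.univ) (t := Finset.univ)
      (fun _ _ => Finset.mem_coe.2 (Finset.mem_univ _))
    simp only [key, Finset.sum_const, Finset.card_univ, smul_eq_mul] at this
    rw [this]; push_cast; ring
  have hsum : (∑ a, if p (f a) then (1 : ℝ) else 0) = n * ∑ b, if p b then (1 : ℝ) else 0 := by
    rw [← Finset.sum_fiberwise (s := Finset.univ) (g := f)]
    rw [Finset.mul_sum]
    refine Finset.sum_congr rfl fun b _ => ?_
    rw [Finset.sum_congr rfl (g := fun _ => if p b then (1 : ℝ) else 0)]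
    · rw [Finset.sum_const, key b, nsmul_eq_mul]
    · intro x hx
      simp only [Finset.mem_filter, Finset.mem_univ, true_and] at hx
      rw [hx]
  have hn0 : (n : ℝ) ≠ 0 := by
    have : 0 < n := Finset.card_pos.2 ⟨0, by simp⟩
    positivity
  unfold prob
  rw [hsum, hcard, mul_div_mul_left _ _ hn0]

/-- Resampling one coordinate preserves the uniform measure. -/
theorem prob_pi_le_of_update {ι H : Type*} [AddCommGroup H] [Fintype H] [Fintype ι]
    [DecidableEq ι] {p : (ι → H) → Prop} (i : ι) {c : ℝ}
    (h : ∀ a, prob (fun g => p (Function.update a i g)) ≤ c) : prob p ≤ c := by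
  rw [← prob_comp_affine (fun z : (ι → H) × H => Function.update z.1 i z.2) ?_ ?_ p]
  · exact prob_prod_le h
  · intro a b c
    funext j
    by_cases hj : j = i
    · subst hj; simp
    · simp [hj]
  · intro y
    exact ⟨(y, y i), by simp⟩

theorem ncard_eq_prob_mul (p : Ω → Prop) [Nonempty Ω] :
    (({a | p a}.ncard : ℕ) : ℝ) = prob p * Fintype.card Ω := by
  classical
  unfold prob
  rw [div_mul_cancel₀ _ (by positivity)]
  rw [Set.ncard_eq_toFinset_card']
  simp

end Prob

/-! ### Alternating sums over subsets -/

/-- The alternating sum `∑_{t ⊆ J} (-1)^{|t|} f(t)`. -/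
def altSum {ι A : Type*} [AddCommGroup A] (J : Finset ι) (f : Finset ι → A) : A :=
  ∑ t ∈ J.powerset, ((-1 : ℤ) ^ t.card) • f t

section AltSum

variable {ι A B : Type*} [AddCommGroup A] [AddCommGroup B]

theorem altSum_congr {J : Finset ι} {f g : Finset ι → A} (h : ∀ t ⊆ J, f t = g t) :
    altSum J f = altSum J g :=
  Finset.sum_congr rfl fun t ht => by rw [h t (Finset.mem_powerset.1 ht)]

theorem altSum_empty (f : Finset ι → A) : altSum ∅ f = f ∅ := by
  simp [altSum]

theorem altSum_sub (J : Finset ι) (f g : Finset ι → A) :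
    altSum J (fun t => f t - g t) = altSum J f - altSum J g := by
  simp [altSum, smul_sub, Finset.sum_sub_distrib]

theorem altSum_map (J : Finset ι) (f : Finset ι → A) (φ : A →+ B) :
    φ (altSum J f) = altSum J fun t => φ (f t) := by
  simp [altSum, map_sum]

theorem altSum_sum {κ : Type*} (J : Finset ι) (s : Finset κ) (f : κ → Finset ι → A) :
    altSum J (fun t => ∑ i ∈ s, f i t) = ∑ i ∈ s, altSum J (f i) := by
  simp only [altSum, Finset.smul_sum]
  exact Finset.sum_comm

theorem altSum_comm {κ : Type*} (J : Finset ι) (L : Finset κ) (f : Finset ι → Finset κ → A) :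
    altSum J (fun t => altSum L fun u => f t u) = altSum L fun u => altSum J fun t => f t u := by
  simp only [altSum, Finset.smul_sum]
  rw [Finset.sum_comm]
  refine Finset.sum_congr rfl fun u _ => Finset.sum_congr rfl fun t _ => ?_
  rw [smul_comm]

theorem altSum_eq_empty_of_forall {J : Finset ι} {f : Finset ι → A}
    (h : ∀ t ⊆ J, t ≠ ∅ → f t = 0) : altSum J f = f ∅ := by
  unfold altSum
  rw [Finset.sum_eq_single ∅]
  · simp
  · intro t ht h0
    rw [h t (Finset.mem_powerset.1 ht) h0, smul_zero]
  · simp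

theorem altSum_seminorm_le [Fintype ι] (N : AddGroupSeminorm A) (J : Finset ι)
    (f : Finset ι → A) {R : ℝ} (hR0 : 0 ≤ R) (hR : ∀ t ⊆ J, N (f t) ≤ R) : N (altSum J f) ≤ 2 ^ Fintype.card ι * R := by
  have h1 : ∀ t : Finset ι, N (((-1 : ℤ) ^ t.card) • f t) = N (f t) := fun t => by
    rcases neg_one_pow_eq_or ℤ t.card with h | h <;> rw [h] <;> simp
  calc N (altSum J f) ≤ ∑ t ∈ J.powerset, N (((-1 : ℤ) ^ t.card) • f t) :=
        Finset.le_sum_of_subadditive N (map_zero N).le (fun a b => map_add_le_add N a b) _ _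
    _ ≤ ∑ t ∈ J.powerset, R := Finset.sum_le_sum fun t ht => by
        rw [h1]; exact hR t (Finset.mem_powerset.1 ht)
    _ = 2 ^ J.card * R := by simp [Finset.card_powerset]
    _ ≤ 2 ^ Fintype.card ι * R := by
        gcongr
        · norm_num
        · exact Finset.card_le_univ J

variable [DecidableEq ι]

theorem altSum_insert {i : ι} {s : Finset ι} (hi : i ∉ s) (f : Finset ι → A) :
    altSum (insert i s) f = altSum s f - altSum s fun t => f (insert i t) := by
  unfold altSum
  rw [Finset.sum_powerset_insert hi, sub_eq_add_neg, ← Finset.sum_neg_distrib]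
  congr 1
  refine Finset.sum_congr rfl fun t ht => ?_
  rw [Finset.card_insert_of_notMem fun h => hi (Finset.mem_powerset.1 ht h), pow_succ]
  simp

theorem altSum_sdiff_eq_zero {J φ : Finset ι} {i : ι} (hJ : i ∈ J) (hφ : i ∈ φ)
    (f : Finset ι → A) : altSum J (fun t => f (t \ φ)) = 0 := by
  rw [← Finset.insert_erase hJ, altSum_insert (Finset.notMem_erase i J)]
  simp [Finset.insert_sdiff_of_mem _ hφ]

theorem altSum_const {J : Finset ι} (hJ : J.Nonempty) (a : A) :
    altSum J (fun _ => a) = 0 := by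
  obtain ⟨i, hi⟩ := hJ
  exact altSum_sdiff_eq_zero hi hi (fun _ => a)

end AltSum

/-! ### Corner decompositions of cubes -/

/-- The total displacement `∑_{j ∈ ω} a_j` from the base of a cube to its vertex `ω`. -/
def dot {ι H : Type*} [AddCommGroup H] (ω : Finset ι) (a : ι → H) : H := ∑ j ∈ ω, a j

/-- The vector `a` with the coordinates outside `ω` replaced by `0`. -/
def res {ι H : Type*} [AddCommGroup H] [DecidableEq ι] (ω : Finset ι) (a : ι → H) : ι → H :=
  fun j => if j ∈ ω then a j else 0

section Corner

variable {ι H A : Type*} [AddCommGroup H] [AddCommGroup A]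

theorem dot_empty (a : ι → H) : dot ∅ a = 0 := rfl

theorem dot_congr {s : Finset ι} {a b : ι → H} (h : ∀ j ∈ s, a j = b j) : dot s a = dot s b :=
  Finset.sum_congr rfl h

variable [DecidableEq ι]

theorem dot_insert {i : ι} {s : Finset ι} (hi : i ∉ s) (a : ι → H) :
    dot (insert i s) a = a i + dot s a := Finset.sum_insert hi

theorem res_empty (a : ι → H) : res ∅ a = 0 := by
  funext j; simp [res]

theorem dot_add_dot_sub_res (θ φ : Finset ι) (a t : ι → H) :
    dot θ a + dot φ (t - res θ a) = dot (θ \ φ) a + dot φ t := by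
  have h : dot φ (t - res θ a) = dot φ t - dot (θ ∩ φ) a := by
    unfold dot res
    simp only [Pi.sub_apply, Finset.sum_sub_distrib]
    rw [Finset.sum_ite_mem, Finset.inter_comm]
  have h2 : dot θ a = dot (θ \ φ) a + dot (θ ∩ φ) a := by
    unfold dot
    rw [← Finset.sum_sdiff (Finset.inter_subset_left (s₁ := θ) (s₂ := φ))]
    congr 2
    ext; simp
  rw [h, h2]; abel

theorem res_add_res_sub_res (θ φ : Finset ι) (a t : ι → H) :
    res θ a + res φ (t - res θ a) = res (θ \ φ) a + res φ t := by
  funext j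
  simp only [res, Pi.add_apply, Pi.sub_apply, Finset.mem_sdiff]
  by_cases h1 : j ∈ θ <;> by_cases h2 : j ∈ φ <;> simp [h1, h2]

/-- The alternating sum of `F` over the corners of the cube with base `x` and directions `a` in
the coordinates `J`: the corner at the vertex `ω` is based at that vertex and points towards the
common opposite vertex, at displacement `h` from `x`. -/
def corners (J : Finset ι) (F : H → (ι → H) → A) (x : H) (a h : ι → H) : A :=
  altSum J fun ω => F (x + dot ω a) (h - res ω a)

theorem altSum_corner_eq_zero {J φ : Finset ι} {i : ι} (hJ : i ∈ J) (hφ : i ∈ φ)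
    (F : H → (ι → H) → A) (x : H) (a t h : ι → H) :
    altSum J (fun θ => F (x + dot θ a + dot φ (t - res θ a))
      (h - res θ a - res φ (t - res θ a))) = 0 := by
  have : ∀ θ : Finset ι, F (x + dot θ a + dot φ (t - res θ a))
      (h - res θ a - res φ (t - res θ a)) =
      F (x + (dot (θ \ φ) a + dot φ t)) (h - (res (θ \ φ) a + res φ t)) := by
    intro θ
    rw [add_assoc, dot_add_dot_sub_res, sub_sub, res_add_res_sub_res]
  simp only [this]
  exact altSum_sdiff_eq_zero hJ hφ
    (fun θ => F (x + (dot θ a + dot φ t)) (h - (res θ a + res φ t)))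

/-- A sum over corners itself satisfies the corner decomposition: all other contributions cancel
in pairs. -/
theorem altSum_corners (J : Finset ι) (F : H → (ι → H) → A) (x : H) (a t h : ι → H) :
    altSum J (fun θ => corners J F (x + dot θ a) (t - res θ a) (h - res θ a)) =
      corners J F x a h := by
  unfold corners
  rw [altSum_comm, altSum_eq_empty_of_forall]
  · simp [dot_empty, res_empty]
  · intro φ hφ h0
    obtain ⟨i, hi⟩ := Finset.nonempty_iff_ne_empty.2 h0
    exact altSum_corner_eq_zero (hφ hi) hi F x a t h

end Corner

/-! ### Approximate cocycles on a dense set of cubes -/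

section Potential

variable {ι H A : Type*} [AddCommGroup H] [DecidableEq ι] [AddCommGroup A]

/-- In coordinate `i` the cube `(x; h)` runs from `x` to `x + h i`. The two cubes that run from `x`,
and from `x + h i`, to the third point `x + g` instead lie in `G`. In a coordinate outside `J` only
the cube starting at `x` counts. -/
def Neighbours (J : Finset ι) (G : H → (ι → H) → Prop) (i : ι) (x : H) (h : ι → H) (g : H) :
    Prop :=
  G x (Function.update h i g) ∧ (i ∈ J → G (x + h i) (Function.update h i (g - h i)))

open Classical in
/-- The cocycle relation between a cube and its two neighbours in direction `i`. In a coordinate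
outside `J` it says that the value does not depend on that coordinate. -/
def Glued (J : Finset ι) (σ : H → (ι → H) → A) (i : ι) (x : H) (h : ι → H) (g : H) : Prop :=
  σ x h = σ x (Function.update h i g) -
    if i ∈ J then σ (x + h i) (Function.update h i (g - h i)) else 0

/-- `σ` is a cocycle up to an error of proportion `δ` on the set `G` of cubes `(x; h)`, in the
directions `J`; it is nearly independent of the remaining directions. Moreover `G` is closed, up
to proportion `ε`, under moving a coordinate; this bound holds at each cube of `G`, so that it
survives even when `ε` is much larger than `δ`. -/
structure IsPartialCocycle [Fintype ι] [Fintype H] (J : Finset ι) (G : H → (ι → H) → Prop)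
    (σ : H → (ι → H) → A) (ε δ : ℝ) : Prop where
  near : ∀ i x h, G x h → prob (fun g => ¬ Neighbours J G i x h g) ≤ ε
  glued : ∀ i, prob (fun z : H × (ι → H) × H =>
    G z.1 z.2.1 ∧ Neighbours J G i z.1 z.2.1 z.2.2 ∧ ¬ Glued J σ i z.1 z.2.1 z.2.2) ≤ δ

theorem piecewise_sub_res_insert {i : ι} {s ω : Finset ι} (hi : i ∉ s)
    (h h' : ι → H) : (insert i s).piecewise (h' - res (insert i ω) h) h =
      Function.update (s.piecewise (h' - res ω h) h) i (h' i - h i) := by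
  rw [Finset.piecewise_insert]
  congr 1
  · refine Finset.piecewise_congr _ (fun j hj => ?_) (fun _ _ => rfl)
    have : j ≠ i := fun e => hi (e ▸ hj)
    simp [res, this]
  · simp [res]

theorem piecewise_sub_res {i : ι} {s ω : Finset ι} (hi : i ∉ s) (hω : ω ⊆ s)
    (h h' : ι → H) : (insert i s).piecewise (h' - res ω h) h =
      Function.update (s.piecewise (h' - res ω h) h) i (h' i) := by
  rw [Finset.piecewise_insert]
  congr 1
  have : i ∉ ω := fun e => hi (hω e)
  simp [res, this]

variable [Fintype ι] [Fintype H]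

/-- The map that sends a cube with a second set of directions to an intermediate corner, together
with a further direction, is affine and onto, hence preserves the uniform measure. -/
theorem prob_comp_corner {i : ι} {s ω : Finset ι} (hi : i ∉ s) (hω : ω ⊆ s)
    (p : H × (ι → H) × H → Prop) :
    prob (fun z : H × (ι → H) × (ι → H) =>
      p (z.1 + dot ω z.2.1, s.piecewise (z.2.2 - res ω z.2.1) z.2.1, z.2.2 i)) = prob p := by
  refine prob_comp_affine (fun z : H × (ι → H) × (ι → H) =>
      (z.1 + dot ω z.2.1, s.piecewise (z.2.2 - res ω z.2.1) z.2.1, z.2.2 i)) ?_ ?_ p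
  · rintro ⟨x, h, t⟩ ⟨x', h', t'⟩ ⟨x'', h'', t''⟩
    refine Prod.ext ?_ (Prod.ext ?_ ?_)
    · simp only [dot, Prod.fst_add, Prod.fst_sub, Prod.snd_add, Prod.snd_sub, Pi.add_apply,
        Pi.sub_apply, Finset.sum_add_distrib, Finset.sum_sub_distrib]
      abel
    · funext j
      by_cases hj : j ∈ s <;> by_cases hj' : j ∈ ω <;> simp [res, hj, hj']
      all_goals abel
    · simp
  · rintro ⟨y, q, g⟩
    refine ⟨(y, s.piecewise 0 q, Function.update q i g), ?_⟩
    have h0 : dot ω (s.piecewise 0 q) = 0 :=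
      Finset.sum_eq_zero fun j hj => by simp [hω hj]
    have h1 : res ω (s.piecewise 0 q) = 0 := by
      funext j
      by_cases hj : j ∈ ω
      · simp [res, hω hj]
      · simp [res, hj]
    simp only [h0, h1, add_zero, sub_zero, Function.update_self]
    refine Prod.ext rfl (Prod.ext ?_ rfl)
    funext j
    by_cases hj : j ∈ s
    · have : j ≠ i := fun e => hi (e ▸ hj)
      simp [hj, this]
    · simp [hj]

variable {J : Finset ι} {G : H → (ι → H) → Prop} {σ : H → (ι → H) → A} {ε δ : ℝ}

/-- The decomposition of a cube into corners, for the coordinates in `s`. The failures split into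
an event `P`, small at every cube of `G`, where a corner leaves `G`, and an event `Q` of total
proportion `O(δ)` where a cocycle relation fails. -/
theorem IsPartialCocycle.exists_partial_decomposition (hσ : IsPartialCocycle J G σ ε δ)
    (hε : 0 ≤ ε) (hδ : 0 ≤ δ) (s : Finset ι) :
    ∃ P Q : H → (ι → H) → (ι → H) → Prop,
      (∀ x h, G x h → prob (P x h) ≤ 2 ^ s.card * ε) ∧
      prob (fun z : H × (ι → H) × (ι → H) => Q z.1 z.2.1 z.2.2) ≤ 2 ^ s.card * δ ∧
      ∀ x h h', G x h → ¬ P x h h' →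
        (∀ ω ⊆ s ∩ J, G (x + dot ω h) (s.piecewise (h' - res ω h) h)) ∧
        (¬ Q x h h' → σ x h =
          altSum (s ∩ J) fun ω => σ (x + dot ω h) (s.piecewise (h' - res ω h) h)) := by
  classical
  induction s using Finset.induction_on with
  | empty =>
    refine ⟨fun _ _ _ => False, fun _ _ _ => False, ?_, ?_, ?_⟩
    · intro x h _; rw [prob_false]; positivity
    · rw [prob_false]; positivity
    · intro x h h' hG _
      refine ⟨fun ω hω => ?_, fun _ => ?_⟩
      · have : ω = ∅ := by simpa using hω
        simpa [this, dot_empty] using hG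
      · rw [Finset.empty_inter, altSum_empty]
        simp [dot_empty]
  | insert i s hi ih =>
    obtain ⟨P, Q, hP, hQ, hPQ⟩ := ih
    have hcard : ((s ∩ J).powerset.card : ℝ) ≤ 2 ^ s.card := by
      rw [Finset.card_powerset]; push_cast
      gcongr
      · norm_num
      · exact Finset.inter_subset_left
    have hsub : ∀ ω ∈ (s ∩ J).powerset, ω ⊆ s := fun ω hω =>
      (Finset.mem_powerset.1 hω).trans Finset.inter_subset_left
    refine ⟨fun x h h' => P x h h' ∨ ∃ ω ∈ (s ∩ J).powerset,
        G (x + dot ω h) (s.piecewise (h' - res ω h) h) ∧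
        ¬ Neighbours J G i (x + dot ω h) (s.piecewise (h' - res ω h) h) (h' i),
      fun x h h' => Q x h h' ∨ ∃ ω ∈ (s ∩ J).powerset,
        G (x + dot ω h) (s.piecewise (h' - res ω h) h) ∧
        Neighbours J G i (x + dot ω h) (s.piecewise (h' - res ω h) h) (h' i) ∧
        ¬ Glued J σ i (x + dot ω h) (s.piecewise (h' - res ω h) h) (h' i), ?_, ?_, ?_⟩
    · intro x h hG
      refine (prob_or_le _ _).trans ?_
      rw [Finset.card_insert_of_notMem hi, pow_succ, mul_two, add_mul]
      refine add_le_add (hP x h hG) ((prob_exists_le _ _).trans ?_)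
      calc _ ≤ ∑ ω ∈ (s ∩ J).powerset, ε := by
            refine Finset.sum_le_sum fun ω hω => ?_
            refine prob_pi_le_of_update i fun a => ?_
            have hp : ∀ g, s.piecewise (Function.update a i g - res ω h) h =
                s.piecewise (a - res ω h) h := fun g =>
              Finset.piecewise_congr _ (fun j hj => by
                have : j ≠ i := fun e => hi (e ▸ hj)
                simp [this]) (fun _ _ => rfl)
            simp only [hp, Function.update_self]
            by_cases hG' : G (x + dot ω h) (s.piecewise (a - res ω h) h)
            · simpa only [hG', true_and] using hσ.near i _ _ hG'
            · simpa only [hG', false_and, prob_false] using hε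
        _ ≤ 2 ^ s.card * ε := by
            rw [Finset.sum_const, nsmul_eq_mul]
            gcongr
    · refine (prob_or_le _ _).trans ?_
      rw [Finset.card_insert_of_notMem hi, pow_succ, mul_two, add_mul]
      refine add_le_add hQ ((prob_exists_le _ _).trans ?_)
      calc _ ≤ ∑ ω ∈ (s ∩ J).powerset, δ := by
            refine Finset.sum_le_sum fun ω hω => ?_
            refine le_trans (le_of_eq ?_) (hσ.glued i)
            exact prob_comp_corner hi (hsub ω hω) (fun z : H × (ι → H) × H =>
              G z.1 z.2.1 ∧ Neighbours J G i z.1 z.2.1 z.2.2 ∧ ¬ Glued J σ i z.1 z.2.1 z.2.2)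
        _ ≤ 2 ^ s.card * δ := by
            rw [Finset.sum_const, nsmul_eq_mul]
            gcongr
    · intro x h h' hG hP'
      simp only [not_or, not_exists, not_and, not_not] at hP'
      obtain ⟨hP1, hP2⟩ := hP'
      obtain ⟨hc, he⟩ := hPQ x h h' hG hP1
      have hnb : ∀ ω ∈ (s ∩ J).powerset,
          Neighbours J G i (x + dot ω h) (s.piecewise (h' - res ω h) h) (h' i) :=
        fun ω hω => hP2 ω hω (hc ω (Finset.mem_powerset.1 hω))
      have hpi : ∀ ω : Finset ι, s.piecewise (h' - res ω h) h i = h i := fun ω => by simp [hi]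
      have hdot : ∀ ω ⊆ s, x + dot (insert i ω) h = x + dot ω h + h i := fun ω hω => by
        rw [dot_insert fun e => hi (hω e)]; abel
      by_cases hiJ : i ∈ J
      · rw [Finset.insert_inter_of_mem hiJ]
        have hiJ' : i ∉ s ∩ J := fun e => hi (Finset.mem_inter.1 e).1
        constructor
        · intro ω hω
          by_cases hiω : i ∈ ω
          · have hω' : ω.erase i ∈ (s ∩ J).powerset := by
              rw [Finset.mem_powerset, ← Finset.subset_insert_iff]; exact hω
            have := (hnb _ hω').2 hiJ
            rw [hpi, ← piecewise_sub_res_insert hi, ← hdot _ (hsub _ hω'),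
              Finset.insert_erase hiω] at this
            exact this
          · have hω' : ω ∈ (s ∩ J).powerset :=
              Finset.mem_powerset.2 ((Finset.subset_insert_iff_of_notMem hiω).1 hω)
            have := (hnb _ hω').1
            rwa [← piecewise_sub_res hi (hsub _ hω')] at this
        · intro hQ'
          simp only [not_or, not_exists, not_and, not_not] at hQ'
          rw [he hQ'.1, altSum_insert hiJ', ← altSum_sub]
          refine altSum_congr fun ω hω => ?_
          have hω' := Finset.mem_powerset.2 hω
          have := hQ'.2 ω hω' (hc ω hω) (hnb ω hω')
          rw [Glued, if_pos hiJ, hpi] at this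
          rw [this, piecewise_sub_res hi (hsub _ hω'), piecewise_sub_res_insert hi,
            hdot _ (hsub _ hω')]
      · rw [Finset.insert_inter_of_notMem hiJ]
        constructor
        · intro ω hω
          have hω' := Finset.mem_powerset.2 hω
          rw [piecewise_sub_res hi (hsub _ hω')]
          exact (hnb _ hω').1
        · intro hQ'
          simp only [not_or, not_exists, not_and, not_not] at hQ'
          rw [he hQ'.1]
          refine altSum_congr fun ω hω => ?_
          have hω' := Finset.mem_powerset.2 hω
          have := hQ'.2 ω hω' (hc ω hω) (hnb ω hω')
          rw [Glued, if_neg hiJ, sub_zero] at this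
          rw [this, piecewise_sub_res hi (hsub _ hω')]

/-- Almost every cube of `G` is the alternating sum of the corners pointing towards almost every
common opposite vertex. -/
theorem IsPartialCocycle.exists_decomposition (hσ : IsPartialCocycle J G σ ε δ)
    (hε : 0 ≤ ε) (hδ : 0 ≤ δ) :
    ∃ P Q : H → (ι → H) → (ι → H) → Prop,
      (∀ x h, G x h → prob (P x h) ≤ 2 ^ Fintype.card ι * ε) ∧
      prob (fun z : H × (ι → H) × (ι → H) => Q z.1 z.2.1 z.2.2) ≤ 2 ^ Fintype.card ι * δ ∧
      ∀ x h h', G x h → ¬ P x h h' →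
        (∀ ω ⊆ J, G (x + dot ω h) (h' - res ω h)) ∧
        (¬ Q x h h' → σ x h = corners J σ x h h') := by
  have := hσ.exists_partial_decomposition hε hδ Finset.univ
  simpa only [Finset.card_univ, Finset.univ_inter, Finset.piecewise_univ,
    corners] using this

end Potential

/-! ### From partial to exact cocycles -/

section Exact

variable {ι H A : Type*} [AddCommGroup H] [DecidableEq ι] [AddCommGroup A]
variable [Fintype ι] [Fintype H]
variable {J : Finset ι} {G : H → (ι → H) → Prop} {σ : H → (ι → H) → A} {ε δ : ℝ}

theorem prob_sub_right {V : Type*} [AddCommGroup V] [Fintype V] (c : V) (p : V → Prop) :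
    prob (fun v => p (v - c)) = prob p :=
  prob_comp_equiv (Equiv.subRight c) p

theorem prob_corner_fixed_base {ω : Finset ι} (hω : ω ≠ ∅) (x : H)
    (p : H × (ι → H) × (ι → H) → Prop) :
    prob (fun z : (ι → H) × (ι → H) × (ι → H) =>
      p (x + dot ω z.1, z.2.1 - res ω z.1, z.2.2 - res ω z.1)) = prob p := by
  refine prob_comp_affine (fun z : (ι → H) × (ι → H) × (ι → H) =>
      (x + dot ω z.1, z.2.1 - res ω z.1, z.2.2 - res ω z.1)) ?_ ?_ p
  · have hres : ∀ a b c : ι → H, res ω (a - b + c) = res ω a - res ω b + res ω c := by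
      intro a b c
      funext j
      by_cases hj : j ∈ ω <;> simp [res, hj]
    rintro ⟨h, t, u⟩ ⟨h', t', u'⟩ ⟨h'', t'', u''⟩
    refine Prod.ext ?_ (Prod.ext ?_ ?_)
    · simp only [dot, Prod.fst_add, Prod.fst_sub, Pi.add_apply,
        Pi.sub_apply, Finset.sum_add_distrib, Finset.sum_sub_distrib]
      abel
    · simp only [Prod.fst_add, Prod.fst_sub, Prod.snd_add, Prod.snd_sub, hres]
      abel
    · simp only [Prod.fst_add, Prod.fst_sub, Prod.snd_add, Prod.snd_sub, hres]
      abel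
  · rintro ⟨y, p, q⟩
    obtain ⟨i, hi⟩ := Finset.nonempty_iff_ne_empty.2 hω
    refine ⟨(Pi.single i (y - x), p + res ω (Pi.single i (y - x)),
      q + res ω (Pi.single i (y - x))), ?_⟩
    have : dot ω (Pi.single i (y - x)) = y - x := by
      simp [dot, hi]
    simp [this]

theorem prob_vertex (ω : Finset ι) (p : H → Prop) :
    prob (fun z : H × (ι → H) => p (z.1 + dot ω z.2)) = prob p := by
  refine prob_comp_affine (fun z : H × (ι → H) => z.1 + dot ω z.2) ?_ ?_ p
  · rintro ⟨x, h⟩ ⟨x', h'⟩ ⟨x'', h''⟩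
    simp only [dot, Prod.fst_add, Prod.fst_sub, Prod.snd_add, Prod.snd_sub, Pi.add_apply,
        Pi.sub_apply, Finset.sum_add_distrib, Finset.sum_sub_distrib]
    abel
  · intro y
    exact ⟨(y, 0), by simp [dot]⟩

/-- If `E x` is given at each `x` such that its increments `E x h' - E x h` are mostly those
prescribed by `σ`, then the sums of `E` over corners are mostly independent of the opposite
vertex. Their popular values form an exact cocycle. -/
theorem exists_exact_of_increments (E : H → (ι → H) → A) {τ : ℝ} (hτ0 : 0 ≤ τ)
    (hτ : 2 * (2 ^ Fintype.card ι * (2 ^ Fintype.card ι * τ)) < 1)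
    (hE : ∀ x, prob (fun z : (ι → H) × (ι → H) =>
      E x z.2 - E x z.1 ≠ σ x z.2 - corners J σ x z.1 z.2) ≤ τ) :
    ∃ κ : H → (ι → H) → A,
      (∀ x a, ∃ h, κ x a = corners J E x a h) ∧
      (∀ x a, prob (fun h => corners J E x a h ≠ κ x a) ≤ 2 ^ Fintype.card ι * τ) ∧
      ∀ x a t, κ x a = corners J κ x a t := by
  have hD : (1 : ℝ) ≤ 2 ^ Fintype.card ι := one_le_pow₀ (by norm_num)
  set D : ℝ := 2 ^ Fintype.card ι with hDdef
  have h1 : ∀ x a, ∃ h₀, prob (fun h => corners J E x a h ≠ corners J E x a h₀) ≤ D * τ := by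
    intro x a
    have h2 : prob (fun z : (ι → H) × (ι → H) =>
        corners J E x a z.2 ≠ corners J E x a z.1) ≤ D * τ := by
      refine le_trans (prob_mono ?_) (prob_exists_subset_le J
        (fun θ (z : (ι → H) × (ι → H)) =>
          E (x + dot θ a) (z.2 - res θ a) - E (x + dot θ a) (z.1 - res θ a) ≠
          σ (x + dot θ a) (z.2 - res θ a) -
            corners J σ (x + dot θ a) (z.1 - res θ a) (z.2 - res θ a)) ?_ hτ0)
      · rintro ⟨h, h'⟩ hne
        by_contra hcon
        simp only [not_exists, not_and, not_not, Finset.mem_powerset] at hcon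
        refine hne (sub_eq_zero.1 ?_)
        calc corners J E x a h' - corners J E x a h
            = altSum J (fun θ => σ (x + dot θ a) (h' - res θ a) -
              corners J σ (x + dot θ a) (h - res θ a) (h' - res θ a)) := by
              unfold corners
              rw [← altSum_sub]
              exact altSum_congr hcon
          _ = corners J σ x a h' - corners J σ x a h' := by
              rw [altSum_sub, altSum_corners]
              rfl
          _ = 0 := sub_self _
      · intro θ _
        refine le_trans (le_of_eq ?_) (hE (x + dot θ a))
        exact prob_comp_equiv (Equiv.subRight ((res θ a, res θ a) : (ι → H) × (ι → H)))
          (fun z => E (x + dot θ a) z.2 - E (x + dot θ a) z.1 ≠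
            σ (x + dot θ a) z.2 - corners J σ (x + dot θ a) z.1 z.2)
    obtain ⟨h₀, hh₀⟩ := exists_prob_section_le (fun z : (ι → H) × (ι → H) =>
        corners J E x a z.2 ≠ corners J E x a z.1)
    exact ⟨h₀, hh₀.trans h2⟩
  choose h₀ hh₀ using h1
  refine ⟨fun x a => corners J E x a (h₀ x a), fun x a => ⟨_, rfl⟩, hh₀, ?_⟩
  intro x a t
  have h3 : prob (fun h => corners J E x a h ≠ corners J E x a (h₀ x a) ∨
      ∃ θ ∈ J.powerset, corners J E (x + dot θ a) (t - res θ a) (h - res θ a) ≠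
        corners J E (x + dot θ a) (t - res θ a) (h₀ (x + dot θ a) (t - res θ a))) < 1 := by
    refine lt_of_le_of_lt ((prob_or_le _ _).trans (add_le_add (hh₀ x a)
      (prob_exists_subset_le J (c := D * τ) _ (fun θ _ => ?_) (by positivity)))) ?_
    · exact (prob_sub_right (res θ a) (fun h => corners J E (x + dot θ a) (t - res θ a) h ≠
        corners J E (x + dot θ a) (t - res θ a) (h₀ (x + dot θ a) (t - res θ a)))).trans_le
        (hh₀ _ _)
    · have : D * τ ≤ D * (D * τ) := le_mul_of_one_le_left (by positivity) hD
      linarith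
  obtain ⟨h, hh⟩ := exists_not_of_prob_lt_one h3
  simp only [not_or, not_exists, not_and, not_not, Finset.mem_powerset] at hh
  change corners J E x a (h₀ x a) = _
  rw [← hh.1, ← altSum_corners J E x a t h]
  exact altSum_congr hh.2

/-- If almost all cubes satisfy the corner decomposition, then at *every* point `x` there is a
function with the increments prescribed by `σ`, because the cubes that prescribe them do not have
`x` as their base. -/
theorem exists_increments {γ : ℝ} (hγ0 : 0 ≤ γ)
    (hγ : prob (fun z : H × (ι → H) × (ι → H) =>
      σ z.1 z.2.1 ≠ corners J σ z.1 z.2.1 z.2.2) ≤ γ) (x : H) :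
    ∃ h₀, prob (fun z : (ι → H) × (ι → H) =>
      (σ x z.2 - corners J σ x h₀ z.2) - (σ x z.1 - corners J σ x h₀ z.1) ≠
        σ x z.2 - corners J σ x z.1 z.2) ≤ 2 ^ Fintype.card ι * γ := by
  have h1 : prob (fun z : (ι → H) × (ι → H) × (ι → H) =>
      (σ x z.2.2 - corners J σ x z.1 z.2.2) - (σ x z.2.1 - corners J σ x z.1 z.2.1) ≠
        σ x z.2.2 - corners J σ x z.2.1 z.2.2) ≤ 2 ^ Fintype.card ι * γ := by
    refine le_trans (prob_mono ?_) (prob_exists_subset_le J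
        (fun ω (z : (ι → H) × (ι → H) × (ι → H)) => ω ≠ ∅ ∧
          σ (x + dot ω z.1) (z.2.1 - res ω z.1) ≠
          corners J σ (x + dot ω z.1) (z.2.1 - res ω z.1) (z.2.2 - res ω z.1)) ?_ hγ0)
    · rintro ⟨h, h', h''⟩ hne
      by_contra hcon
      simp only [not_exists, not_and, not_not, Finset.mem_powerset] at hcon
      refine hne ?_
      -- Only the term at the base `x` may differ from the corner decomposition.
      have key : corners J σ x h h' - corners J σ x h h'' =
          σ x h' - corners J σ x h' h'' := by
        rw [← altSum_corners J σ x h h' h'']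
        unfold corners at hcon ⊢
        rw [← altSum_sub, altSum_eq_empty_of_forall]
        · simp [dot_empty, res_empty]
        · intro ω hω h0
          rw [hcon ω hω h0, sub_self]
      have : corners J σ x h h' = σ x h' - corners J σ x h' h'' + corners J σ x h h'' := by
        rw [← key]; abel
      simp only [this]
      abel
    · intro ω _
      by_cases h0 : ω = ∅
      · simp only [h0, ne_eq, not_true_eq_false, false_and, prob_false]
        exact hγ0
      · simp only [h0, ne_eq, not_false_eq_true, true_and]
        exact (prob_corner_fixed_base h0 x (fun z => ¬ σ z.1 z.2.1 =
          corners J σ z.1 z.2.1 z.2.2)).trans_le hγ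
  obtain ⟨h₀, hh₀⟩ := exists_prob_section_le (fun z : (ι → H) × (ι → H) × (ι → H) =>
      (σ x z.2.2 - corners J σ x z.1 z.2.2) - (σ x z.2.1 - corners J σ x z.1 z.2.1) ≠
        σ x z.2.2 - corners J σ x z.2.1 z.2.2)
  exact ⟨h₀, hh₀.trans h1⟩

/-- All vertices of a cube of `G` are bases of many cubes of `G`. -/
theorem IsPartialCocycle.dense_at_vertices (hσ : IsPartialCocycle J G σ ε δ)
    (hε : 0 ≤ ε) (hδ : 0 ≤ δ) {x : H} {h : ι → H} (hG : G x h) {ω : Finset ι} (hω : ω ⊆ J) :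
    prob (fun h' => ¬ G (x + dot ω h) h') ≤ 2 ^ Fintype.card ι * ε := by
  obtain ⟨P, Q, hP, -, hPQ⟩ := hσ.exists_decomposition hε hδ
  refine le_trans ?_ (hP x h hG)
  rw [← prob_sub_right (res ω h)]
  refine prob_mono fun h' hn => ?_
  by_contra hcon
  exact hn ((hPQ x h h' hG hcon).1 ω hω)

theorem IsPartialCocycle.prob_not_dense_le (hσ : IsPartialCocycle J G σ ε δ)
    (hε : 0 ≤ ε) (hδ : 0 ≤ δ) (hJ : J.Nonempty) (hG : ∃ x h, G x h) :
    prob (fun y => ¬ prob (fun h => ¬ G y h) ≤ 2 ^ Fintype.card ι * ε) ≤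
      2 ^ Fintype.card ι * ε := by
  obtain ⟨x, h, hG⟩ := hG
  obtain ⟨i, hi⟩ := hJ
  have h1 := hσ.dense_at_vertices hε hδ hG (Finset.empty_subset J)
  rw [dot_empty, add_zero] at h1
  refine le_trans ?_ h1
  rw [← prob_comp_affine (fun h : ι → H => x + h i) ?_ ?_]
  · refine prob_mono fun h' hn hG' => hn ?_
    have := hσ.dense_at_vertices hε hδ hG' (ω := {i}) (by simpa using hi)
    simpa [dot] using this
  · intro a b c
    simp only [Pi.add_apply, Pi.sub_apply]; abel
  · intro y
    exact ⟨fun _ => y - x, by simp⟩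

theorem IsPartialCocycle.prob_not_mem_le (hσ : IsPartialCocycle J G σ ε δ)
    (hε : 0 ≤ ε) (hδ : 0 ≤ δ) (hJ : J.Nonempty) (hG : ∃ x h, G x h) :
    prob (fun z : H × (ι → H) => ¬ G z.1 z.2) ≤ 2 * (2 ^ Fintype.card ι * ε) := by
  classical
  rw [two_mul]
  refine le_trans (prob_mono (q := fun z : H × (ι → H) =>
    (¬ prob (fun h => ¬ G z.1 h) ≤ 2 ^ Fintype.card ι * ε) ∨
    (prob (fun h => ¬ G z.1 h) ≤ 2 ^ Fintype.card ι * ε ∧ ¬ G z.1 z.2)) ?_)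
    ((prob_or_le _ _).trans (add_le_add ?_ (prob_prod_le fun y => ?_)))
  · intro z hz
    by_cases h : prob (fun h => ¬ G z.1 h) ≤ 2 ^ Fintype.card ι * ε
    · exact Or.inr ⟨h, hz⟩
    · exact Or.inl h
  · refine le_trans (le_of_eq ?_) (hσ.prob_not_dense_le hε hδ hJ hG)
    exact prob_comp_affine Prod.fst (by simp) Prod.fst_surjective
      (fun y => ¬ prob (fun h => ¬ G y h) ≤ 2 ^ Fintype.card ι * ε)
  · by_cases h : prob (fun h => ¬ G y h) ≤ 2 ^ Fintype.card ι * ε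
    · simp only [h, true_and]
    · simp only [h, false_and, prob_false]; positivity

/-- A partial cocycle agrees, at almost all the cubes where it is defined, with an exact cocycle
on all cubes. -/
theorem IsPartialCocycle.exists_exact (hσ : IsPartialCocycle J G σ ε δ)
    (hJ : J.Nonempty) (hG : ∃ x h, G x h) (hε0 : 0 ≤ ε) (hδ0 : 0 ≤ δ)
    (hε : 32 * (2 ^ Fintype.card ι) ^ 4 * ε ≤ 1) (hδ : 8 * (2 ^ Fintype.card ι) ^ 4 * δ ≤ 1)
    (N : AddGroupSeminorm A) {R : ℝ} (hR0 : 0 ≤ R) (hR : ∀ x h, N (σ x h) ≤ R) :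
    ∃ κ : H → (ι → H) → A,
      (∀ x a t, κ x a = corners J κ x a t) ∧
      (∀ x a, N (κ x a) ≤ 2 * (2 ^ Fintype.card ι) ^ 2 * R) ∧
      prob (fun z : H × (ι → H) => G z.1 z.2 ∧ κ z.1 z.2 ≠ σ z.1 z.2) ≤
        12 * (2 ^ Fintype.card ι) ^ 4 * δ := by
  classical
  have hvertices := fun x h hG ω hω => hσ.dense_at_vertices hε0 hδ0 (x := x) (h := h) hG (ω := ω) hω
  have hmem := hσ.prob_not_mem_le hε0 hδ0 hJ hG
  obtain ⟨P, Q, hP, hQ, hPQ⟩ := hσ.exists_decomposition hε0 hδ0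
  have hD : (1 : ℝ) ≤ 2 ^ Fintype.card ι := one_le_pow₀ (by norm_num)
  have hcorners : ∀ x h h', N (corners J σ x h h') ≤ 2 ^ Fintype.card ι * R := fun x h h' =>
    altSum_seminorm_le N J _ hR0 fun t _ => hR _ _
  have hcornersE : ∀ (E : H → (ι → H) → A) {S : ℝ}, 0 ≤ S → (∀ x h, N (E x h) ≤ S) →
      ∀ x h h', N (corners J E x h h') ≤ 2 ^ Fintype.card ι * S := fun E S hS hE x h h' =>
    altSum_seminorm_le N J _ hS fun t _ => hE _ _
  set D : ℝ := 2 ^ Fintype.card ι with hDdef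
  have hD2 : 1 ≤ D ^ 2 := one_le_pow₀ hD
  have hD3 : 1 ≤ D ^ 3 := one_le_pow₀ hD
  -- `τ` is the threshold for the exceptional probability at a single point.
  obtain ⟨τ, hτ⟩ : ∃ τ : ℝ, τ * (4 * D ^ 2) = 1 := ⟨1 / (4 * D ^ 2), by field_simp⟩
  have hτ0 : 0 < τ := by
    by_contra hneg
    have : τ * (4 * D ^ 2) ≤ 0 := mul_nonpos_of_nonpos_of_nonneg (not_lt.1 hneg) (by positivity)
    linarith
  have hD2ε : 32 * D ^ 2 * ε ≤ τ * 4 := by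
    have : (32 * D ^ 2 * ε) * D ^ 2 ≤ (τ * 4) * D ^ 2 := by nlinarith
    exact le_of_mul_le_mul_right this (by positivity)
  have hD2δ : 8 * D ^ 2 * δ ≤ τ * 4 := by
    have : (8 * D ^ 2 * δ) * D ^ 2 ≤ (τ * 4) * D ^ 2 := by nlinarith
    exact le_of_mul_le_mul_right this (by positivity)
  have hDε : D * ε ≤ D ^ 2 * ε := by
    have : D ≤ D ^ 2 := by nlinarith
    gcongr
  have hτ4 : 4 * τ ≤ 1 := by nlinarith
  -- the decomposition holds for almost all cubes
  have hall : prob (fun z : H × (ι → H) × (ι → H) =>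
      σ z.1 z.2.1 ≠ corners J σ z.1 z.2.1 z.2.2) ≤ 3 * (D * ε) + D * δ := by
    refine (prob_mono (q := fun z : H × (ι → H) × (ι → H) => (¬ G z.1 z.2.1) ∨
      ((G z.1 z.2.1 ∧ P z.1 z.2.1 z.2.2) ∨ Q z.1 z.2.1 z.2.2)) ?_).trans
      ((prob_or_le _ _).trans ((add_le_add (b := 2 * (D * ε)) ?_
        ((prob_or_le _ _).trans (add_le_add (b := D * ε) ?_ hQ))).trans (le_of_eq (by ring))))
    · rintro ⟨x, h, h'⟩ hne
      by_contra hcon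
      simp only [not_or, not_and, not_not] at hcon
      exact hne ((hPQ x h h' hcon.1 (hcon.2.1 hcon.1)).2 hcon.2.2)
    · refine le_trans (le_of_eq ?_) hmem
      exact prob_comp_affine (fun z : H × (ι → H) × (ι → H) => (z.1, z.2.1))
        (fun _ _ _ => rfl) (fun z => ⟨(z.1, z.2, 0), rfl⟩) (fun z => ¬ G z.1 z.2)
    · refine prob_prod_le fun x => prob_prod_le fun h => ?_
      by_cases h1 : G x h
      · simpa only [h1, true_and] using hP x h h1
      · simp only [h1, false_and, prob_false]; positivity
  have hγ : D * (3 * (D * ε) + D * δ) ≤ τ := by nlinarith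
  obtain ⟨h₀, hh₀⟩ : ∃ h₀ : H → ι → H, ∀ x, prob (fun z : (ι → H) × (ι → H) =>
      (σ x z.2 - corners J σ x (h₀ x) z.2) - (σ x z.1 - corners J σ x (h₀ x) z.1) ≠
        σ x z.2 - corners J σ x z.1 z.2) ≤ τ := by
    choose h₀ hh₀ using exists_increments (J := J) (σ := σ) (by positivity) hall
    exact ⟨h₀, fun x => (hh₀ x).trans hγ⟩
  -- At the good points `σ` itself has the right increments.
  let X : H → Prop := fun x => prob (fun z : (ι → H) × (ι → H) =>
    σ x z.1 ≠ corners J σ x z.1 z.2) ≤ τ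
  let E : H → (ι → H) → A := fun x h => if X x then σ x h else σ x h - corners J σ x (h₀ x) h
  have hEX : ∀ x, X x → ∀ h, E x h = σ x h := fun x hx h => if_pos hx
  have hE : ∀ x, prob (fun z : (ι → H) × (ι → H) =>
      E x z.2 - E x z.1 ≠ σ x z.2 - corners J σ x z.1 z.2) ≤ τ := by
    intro x
    by_cases hx : X x
    · simp only [hEX x hx]
      refine (prob_mono fun z hz => ?_).trans hx
      intro heq
      exact hz (by rw [← heq])
    · simpa only [E, if_neg hx] using hh₀ x
  have hEN : ∀ x h, N (E x h) ≤ 2 * D * R := by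
    intro x h
    have h2 : R ≤ D * R := le_mul_of_one_le_left hR0 hD
    by_cases hx : X x
    · rw [hEX x hx]; linarith [hR x h]
    · simp only [E, if_neg hx]
      refine (map_sub_le_add N _ _).trans ?_
      linarith [hR x h, hcorners x (h₀ x) h]
  obtain ⟨κ, hκ, hκE, hexact⟩ := exists_exact_of_increments (J := J) (σ := σ) E hτ0.le
    (by rw [← hDdef]; nlinarith) hE
  refine ⟨κ, hexact, fun x a => ?_, ?_⟩
  · obtain ⟨h, hh⟩ := hκ x a
    rw [hh]
    exact (hcornersE E (by positivity) hEN x a h).trans (le_of_eq (by ring))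
  -- Few points that are bases of many cubes of `G` are bad.
  have hX : prob (fun x => prob (fun h => ¬ G x h) ≤ D * ε ∧ ¬ X x) ≤ 8 * D ^ 3 * δ := by
    have h1 := mul_prob_section_le (fun z : H × (ι → H) × (ι → H) => Q z.1 z.2.1 z.2.2) (τ / 2)
    have h2 : prob (fun x => prob (fun h => ¬ G x h) ≤ D * ε ∧ ¬ X x) ≤
        prob (fun x => τ / 2 ≤ prob (fun z : (ι → H) × (ι → H) => Q x z.1 z.2)) := by
      refine prob_mono ?_
      rintro x ⟨hx1, hx2⟩
      by_contra hcon
      refine hx2 ((prob_mono (q := fun z : (ι → H) × (ι → H) => (¬ G x z.1) ∨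
        ((G x z.1 ∧ P x z.1 z.2) ∨ Q x z.1 z.2)) ?_).trans
        ((prob_or_le _ _).trans ((add_le_add (b := D * ε) ?_
        ((prob_or_le _ _).trans (add_le_add (b := D * ε) ?_ (not_le.1 hcon).le))).trans
          (by nlinarith))))
      · rintro ⟨h, h'⟩ hne
        by_contra hcon
        simp only [not_or, not_and, not_not] at hcon
        exact hne ((hPQ x h h' hcon.1 (hcon.2.1 hcon.1)).2 hcon.2.2)
      · refine le_trans (le_of_eq ?_) hx1
        exact prob_comp_affine (Prod.fst : (ι → H) × (ι → H) → ι → H)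
          (fun _ _ _ => rfl) (fun z => ⟨(z, 0), rfl⟩) (fun h => ¬ G x h)
      · refine prob_prod_le fun h => ?_
        by_cases h1 : G x h
        · simpa only [h1, true_and] using hP x h h1
        · simp only [h1, false_and, prob_false]; positivity
    have h3 := h2.trans (le_of_mul_le_mul_left (a := τ / 2) (b := prob _)
      (c := 8 * D ^ 3 * δ) ?_ (by positivity))
    · exact h3
    · refine h1.trans (hQ.trans (le_of_eq ?_))
      calc D * δ = (τ * (4 * D ^ 2)) * (D * δ) := by rw [hτ, one_mul]
        _ = _ := by ring
  have hagree : prob (fun z : H × (ι → H) => G z.1 z.2 ∧ κ z.1 z.2 ≠ σ z.1 z.2) ≤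
      D * (8 * D ^ 3 * δ) + 4 * (D * δ) := by
    refine (prob_mono (q := fun z : H × (ι → H) => (∃ ω ∈ J.powerset,
      prob (fun h => ¬ G (z.1 + dot ω z.2) h) ≤ D * ε ∧ ¬ X (z.1 + dot ω z.2)) ∨
      1 / 4 ≤ prob (fun h' => Q z.1 z.2 h')) ?_).trans
      ((prob_or_le _ _).trans (add_le_add ?_ ?_))
    · rintro ⟨x, h⟩ ⟨hG1, hne⟩
      by_contra hcon
      simp only [not_or, not_exists, not_and, not_not, Finset.mem_powerset, not_le] at hcon
      obtain ⟨hc1, hc2⟩ := hcon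
      have hXω : ∀ ω ⊆ J, X (x + dot ω h) := fun ω hω => hc1 ω hω (hvertices x h hG1 ω hω)
      have hlt : prob (fun h' => corners J E x h h' ≠ κ x h ∨ (P x h h' ∨ Q x h h')) < 1 := by
        refine lt_of_le_of_lt ((prob_or_le _ _).trans (add_le_add (hκE x h)
          ((prob_or_le _ _).trans (add_le_add (hP x h hG1) hc2.le)))) ?_
        rw [← hDdef]
        nlinarith
      obtain ⟨h', hh'⟩ := exists_not_of_prob_lt_one hlt
      simp only [not_or, not_not] at hh'
      refine hne ?_
      change κ x h = σ x h
      rw [← hh'.1, (hPQ x h h' hG1 hh'.2.1).2 hh'.2.2]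
      exact altSum_congr fun ω hω => hEX _ (hXω ω hω) _
    · refine prob_exists_subset_le J _ (fun ω _ => ?_) (by positivity)
      exact (prob_vertex ω (fun x => prob (fun h => ¬ G x h) ≤ D * ε ∧ ¬ X x)).trans_le hX
    · have h1 := mul_prob_section_le (fun z : (H × (ι → H)) × (ι → H) => Q z.1.1 z.1.2 z.2) (1 / 4)
      have h2 : prob (fun z : (H × (ι → H)) × (ι → H) => Q z.1.1 z.1.2 z.2) ≤ D * δ := by
        refine le_trans (le_of_eq ?_) hQ
        exact prob_comp_equiv (Equiv.prodAssoc H (ι → H) (ι → H))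
          (fun z : H × (ι → H) × (ι → H) => Q z.1 z.2.1 z.2.2)
      linarith
  refine hagree.trans ?_
  have : D ≤ D ^ 4 := le_self_pow₀ hD (by norm_num)
  have : D * δ ≤ D ^ 4 * δ := by gcongr
  nlinarith

end Exact

/-! ### Potentials of exact cocycles -/

/-- The `ℓ¹` norm on `ℤ^d`, as a seminorm on the additive group. -/
def l1Seminorm (d : ℕ) : AddGroupSeminorm (Fin d → ℤ) where
  toFun v := ∑ j, |(v j : ℝ)|
  map_zero' := by simp
  add_le' v w := by
    rw [← Finset.sum_add_distrib]
    exact Finset.sum_le_sum fun j _ => by simpa using abs_add_le (v j : ℝ) (w j)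
  neg' v := by simp

section Average

variable {ι H : Type*} [AddCommGroup H] [DecidableEq ι] [Fintype ι] [Fintype H] {d : ℕ}

/-- An exact cocycle is the derivative of the average of its values over all cubes at a point. -/
theorem exists_potential_of_exact {J : Finset ι} {κ : H → (ι → H) → Fin d → ℤ}
    (hκ : ∀ x a t, κ x a = corners J κ x a t) {R : ℝ} (hR : ∀ x a, l1Seminorm d (κ x a) ≤ R) :
    ∃ lam : H → Fin d → ℝ,
      (∀ x a, altSum J (fun ω => lam (x + dot ω a)) = fun j => (κ x a j : ℝ)) ∧
      ∀ x, ∑ j, |lam x j| ≤ R := by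
  classical
  set n : ℝ := (Fintype.card (ι → H) : ℝ) with hn
  have hn0 : 0 < n := by positivity
  let castHom : (Fin d → ℤ) →+ (Fin d → ℝ) := (Int.castAddHom ℝ).compLeft (Fin d)
  refine ⟨fun x => n⁻¹ • ∑ t, castHom (κ x t), fun x a => ?_, fun x => ?_⟩
  · have h1 : ∀ ω : Finset ι, n⁻¹ • ∑ t, castHom (κ (x + dot ω a) t) =
        n⁻¹ • ∑ t, castHom (κ (x + dot ω a) (t - res ω a)) := by
      intro ω
      congr 1
      exact ((Equiv.subRight (res ω a)).sum_comp fun t => castHom (κ (x + dot ω a) t)).symm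
    have h2 : ∀ t, altSum J (fun ω => castHom (κ (x + dot ω a) (t - res ω a))) =
        castHom (κ x a) := by
      intro t
      rw [← altSum_map, hκ x a t]
      rfl
    simp only [h1]
    refine (altSum_map J (fun ω => ∑ t, castHom (κ (x + dot ω a) (t - res ω a)))
      (DistribSMul.toAddMonoidHom (Fin d → ℝ) n⁻¹)).symm.trans ?_
    rw [altSum_sum]
    simp only [h2, Finset.sum_const, DistribSMul.toAddMonoidHom_apply, Finset.card_univ]
    rw [← Nat.cast_smul_eq_nsmul ℝ, smul_smul, inv_mul_cancel₀ hn0.ne', one_smul]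
    rfl
  · have h1 : ∀ j, |(n⁻¹ • ∑ t, castHom (κ x t)) j| ≤ n⁻¹ * ∑ t, |(κ x t j : ℝ)| := by
      intro j
      rw [Pi.smul_apply, Finset.sum_apply, smul_eq_mul, abs_mul, abs_of_pos (inv_pos.2 hn0)]
      gcongr
      exact Finset.abs_sum_le_sum_abs _ _
    refine (Finset.sum_le_sum fun j _ => h1 j).trans ?_
    rw [← Finset.mul_sum, Finset.sum_comm]
    have h2 : ∑ t, ∑ j, |(κ x t j : ℝ)| ≤ n * R := by
      refine (Finset.sum_le_sum fun t _ => hR x t).trans ?_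
      simp [hn]
    calc n⁻¹ * ∑ t, ∑ j, |(κ x t j : ℝ)| ≤ n⁻¹ * (n * R) := by gcongr
      _ = R := by rw [← mul_assoc, inv_mul_cancel₀ hn0.ne', one_mul]

end Average

/-! ### Rigidity of real-valued polynomials -/

section Rigidity

variable {ι H B : Type*} [AddCommGroup H] [DecidableEq ι] [Fintype H] [AddCommGroup B]

/-- A torsion-free valued function on a finite group is constant if its iterated derivative
vanishes. -/
theorem eq_of_altSum_eq_zero [IsAddTorsionFree B] (s : Finset ι) (P : H → B)
    (hP : ∀ x a, altSum s (fun ω => P (x + dot ω a)) = 0) (x y : H) : P x = P y := by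
  induction s using Finset.induction_on generalizing P x y with
  | empty =>
    simp only [altSum_empty, dot_empty, add_zero] at hP
    rw [hP x 0, hP y 0]
  | insert i s hi ih =>
    -- the difference in any direction `h` is constant, hence zero as `h` has finite order
    have h1 : ∀ h u v, P u - P (u + h) = P v - P (v + h) := by
      intro h u v
      refine ih (fun u => P u - P (u + h)) (fun x a => ?_) u v
      have h2 := hP x (Function.update a i h)
      rw [altSum_insert hi, ← altSum_sub] at h2
      rw [← h2]
      refine altSum_congr fun ω hω => ?_
      have h3 : dot ω (Function.update a i h) = dot ω a := dot_congr fun j hj => by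
        have : j ≠ i := fun e => hi (hω (e ▸ hj))
        simp [this]
      rw [dot_insert fun e => hi (hω e), h3, Function.update_self]
      congr 2
      abel
    have h4 : ∀ h (n : ℕ), P x - P (x + n • h) = n • (P x - P (x + h)) := by
      intro h n
      induction n with
      | zero => simp
      | succ n ihn =>
        rw [succ_nsmul, succ_nsmul, ← ihn, ← add_assoc, h1 h x (x + n • h)]
        abel
    have h5 := h4 (y - x) (Fintype.card H)
    rw [card_nsmul_eq_zero, add_zero, sub_self] at h5
    have h6 := (smul_eq_zero_iff_right (Fintype.card_ne_zero (α := H))).1 h5.symm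
    simpa using sub_eq_zero.1 h6

/-- If the derivative of a torsion-free valued function vanishes on almost all cubes, then the
function takes a fixed value at each point that is the base of sufficiently many such cubes. -/
theorem exists_eq_const_of_prob_altSum_ne_zero [Fintype ι] {J : Finset ι} [IsAddTorsionFree B] (g : H → B) {γ : ℝ}
    (hγ0 : 0 ≤ γ) (hγ : 4 * (2 ^ Fintype.card ι) ^ 2 * γ ≤ 1)
    (hg : prob (fun z : H × (ι → H) => altSum J (fun ω => g (z.1 + dot ω z.2)) ≠ 0) ≤ γ) :
    ∃ b, ∀ x, prob (fun h => altSum J (fun ω => g (x + dot ω h)) ≠ 0) < 3 / 4 → g x = b := by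
  have hD : (1 : ℝ) ≤ 2 ^ Fintype.card ι := one_le_pow₀ (by norm_num)
  set D : ℝ := 2 ^ Fintype.card ι with hDdef
  have hDγ : D * γ ≤ D ^ 2 * γ := by
    have : D ≤ D ^ 2 := by nlinarith
    gcongr
  let der : H → (ι → H) → B := fun x a => altSum J (fun ω => g (x + dot ω a))
  have hder : ∀ x a t, altSum J (fun θ => der (x + dot θ a) (t - res θ a)) = der x a :=
    fun x a t => altSum_corners J (fun x _ => g x) x a t 0
  -- At every point the derivative is mostly constant: this is the amount by which `g` deviates
  -- from a polynomial there.
  have h1 : ∀ x, ∃ t, prob (fun a => der x a ≠ der x t) ≤ D * γ := by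
    intro x
    obtain ⟨t, ht⟩ := exists_prob_section_le (fun z : (ι → H) × (ι → H) =>
      der x z.2 ≠ der x z.1)
    refine ⟨t, ht.trans ?_⟩
    refine le_trans (prob_mono ?_) (prob_exists_subset_le J
        (fun ω (z : (ι → H) × (ι → H)) => ω ≠ ∅ ∧
          der (x + dot ω z.2) (z.1 - res ω z.2) ≠ 0) ?_ hγ0)
    · rintro ⟨t, a⟩ hne
      by_contra hcon
      simp only [not_exists, not_and, not_not, Finset.mem_powerset] at hcon
      refine hne ?_
      change der x a = der x t
      rw [← hder x a t, altSum_eq_empty_of_forall hcon]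
      simp [dot_empty, res_empty]
    · intro ω _
      by_cases h0 : ω = ∅
      · simp only [h0, ne_eq, not_true_eq_false, false_and, prob_false]
        exact hγ0
      · simp only [h0, ne_eq, not_false_eq_true, true_and]
        refine le_trans (le_of_eq ?_) hg
        rw [← prob_comp_affine (Prod.fst : (H × (ι → H)) × (ι → H) → H × (ι → H))
          (fun _ _ _ => rfl) Prod.fst_surjective
          (fun z => altSum J (fun ω => g (z.1 + dot ω z.2)) ≠ 0),
          ← prob_comp_equiv (Equiv.prodAssoc H (ι → H) (ι → H)).symm
          (fun z => altSum J (fun ω => g (z.1.1 + dot ω z.1.2)) ≠ 0),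
          ← prob_corner_fixed_base h0 x]
        refine (prob_comp_affine (fun z : (ι → H) × (ι → H) × (ι → H) => (z.2.1, z.1))
          (fun _ _ _ => rfl) (fun z => ⟨(z.2, z.1, 0), rfl⟩)
          (fun z => ¬ der (x + dot ω z.2) (z.1 - res ω z.2) = 0)).symm
  choose t ht using h1
  have h2 : ∀ x a, altSum J (fun θ => der (x + dot θ a) (t (x + dot θ a))) = der x a := by
    intro x a
    have h3 : prob (fun s => ∃ θ ∈ J.powerset, der (x + dot θ a) (s - res θ a) ≠
        der (x + dot θ a) (t (x + dot θ a))) < 1 := by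
      refine lt_of_le_of_lt (prob_exists_subset_le J (c := D * γ) _ (fun θ _ => ?_)
        (by positivity)) ?_
      · exact (prob_sub_right (res θ a) (fun s => der (x + dot θ a) s ≠
          der (x + dot θ a) (t (x + dot θ a)))).trans_le (ht _)
      · rw [← hDdef]; nlinarith
    obtain ⟨s, hs⟩ := exists_not_of_prob_lt_one h3
    simp only [not_exists, not_and, not_not, Finset.mem_powerset] at hs
    rw [← hder x a s]
    exact altSum_congr fun θ hθ => (hs θ hθ).symm
  have h4 := eq_of_altSum_eq_zero J (fun x => g x - der x (t x)) (fun x a => by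
    rw [altSum_sub, h2]; exact sub_self _)
  refine ⟨g 0 - der 0 (t 0), fun x hx => ?_⟩
  have h5 : prob (fun h => der x h ≠ 0 ∨ der x h ≠ der x (t x)) < 1 := by
    refine lt_of_le_of_lt (prob_or_le _ _) ?_
    have := ht x
    have : prob (fun h => der x h ≠ 0) < 3 / 4 := hx
    nlinarith
  obtain ⟨h, hh⟩ := exists_not_of_prob_lt_one h5
  simp only [not_or, not_not] at hh
  have h6 : der x (t x) = 0 := by rw [← hh.2, hh.1]
  have h7 : g x - der x (t x) = g 0 - der 0 (t 0) := h4 x 0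
  rw [← h7, h6, sub_zero]

end Rigidity

/-! ### Normal forms and derivatives on upper faces -/

section NormalForm

variable {k : ℕ} {A : Type*} [AddCommGroup A]

/-- The vertex of the discrete cube with support `s`. -/
def ind (s : Finset (Fin k)) : DCube k := fun i => decide (i ∈ s)

/-- Vertices of the discrete cube are the same as subsets of the set of coordinates. -/
def indEquiv (k : ℕ) : Finset (Fin k) ≃ DCube k where
  toFun := ind
  invFun ω := Finset.univ.filter fun i => ω i = true
  left_inv s := by ext i; simp [ind]
  right_inv ω := by funext i; simp [ind]

theorem wt_ind (s : Finset (Fin k)) : wt (ind s) = s.card := by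
  simp [wt, ind]

theorem ind_le_ind {s t : Finset (Fin k)} : ind s ≤ ind t ↔ s ⊆ t := by
  simp only [ind, Pi.le_def, Bool.le_iff_imp, decide_eq_true_eq]
  rfl

theorem exists_eq_ind (ω : DCube k) : ∃ s, ω = ind s := ⟨_, ((indEquiv k).right_inv ω).symm⟩

theorem sum_neg_one_pow_sub_left {α : Type*} [Fintype α] [DecidableEq α] (s v : Finset α) :
    ∑ u ∈ Finset.univ.filter (fun u => s ⊆ u ∧ u ⊆ v), (-1 : ℤ) ^ (u.card - s.card) =
      if s = v then 1 else 0 := by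
  by_cases hsv : s ⊆ v
  · have h1 : ∑ u ∈ Finset.univ.filter (fun u => s ⊆ u ∧ u ⊆ v), (-1 : ℤ) ^ (u.card - s.card) =
        ∑ w ∈ (v \ s).powerset, (-1 : ℤ) ^ w.card := by
      refine Finset.sum_bij' (fun u _ => u \ s) (fun w _ => s ∪ w) ?_ ?_ ?_ ?_ ?_
      · intro u hu
        simp only [Finset.mem_filter, Finset.mem_univ, true_and] at hu
        exact Finset.mem_powerset.2 (Finset.sdiff_subset_sdiff hu.2 le_rfl)
      · intro w hw
        simp only [Finset.mem_filter, Finset.mem_univ, true_and]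
        exact ⟨Finset.subset_union_left,
          Finset.union_subset hsv ((Finset.mem_powerset.1 hw).trans Finset.sdiff_subset)⟩
      · intro u hu
        simp only [Finset.mem_filter, Finset.mem_univ, true_and] at hu
        exact Finset.union_sdiff_of_subset hu.1
      · intro w hw
        have : Disjoint w s := Finset.disjoint_of_subset_left (Finset.mem_powerset.1 hw)
          Finset.sdiff_disjoint
        rw [Finset.union_sdiff_left, Finset.sdiff_eq_self_of_disjoint this]
      · intro u hu
        simp only [Finset.mem_filter, Finset.mem_univ, true_and] at hu
        rw [Finset.card_sdiff_of_subset hu.1]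
    rw [h1, Finset.sum_powerset_neg_one_pow_card]
    refine if_congr ?_ rfl rfl
    rw [Finset.sdiff_eq_empty_iff_subset]
    exact ⟨fun h => hsv.antisymm h, fun h => h ▸ le_rfl⟩
  · rw [if_neg fun h => hsv h.le]
    refine Finset.sum_eq_zero fun u hu => ?_
    simp only [Finset.mem_filter, Finset.mem_univ, true_and] at hu
    exact absurd (hu.1.trans hu.2) hsv

theorem sum_neg_one_pow_sub_right {α : Type*} [Fintype α] [DecidableEq α] (s v : Finset α) :
    ∑ u ∈ Finset.univ.filter (fun u => s ⊆ u ∧ u ⊆ v), (-1 : ℤ) ^ (v.card - u.card) =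
      if s = v then 1 else 0 := by
  rw [← if_congr (compl_inj_iff.trans eq_comm : vᶜ = sᶜ ↔ s = v) rfl rfl,
    ← sum_neg_one_pow_sub_left vᶜ sᶜ]
  refine Finset.sum_bij' (fun u _ => uᶜ) (fun u _ => uᶜ) ?_ ?_ ?_ ?_ ?_
  · intro u hu
    simpa [and_comm] using hu
  · intro u hu
    simp only [Finset.mem_filter, Finset.mem_univ, true_and] at hu ⊢
    exact ⟨Finset.subset_compl_comm.1 hu.2, compl_le_iff_compl_le.1 hu.1⟩
  · simp
  · simp
  · intro u hu
    simp only [Finset.mem_filter, Finset.mem_univ, true_and] at hu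
    rw [Finset.card_compl, Finset.card_compl]
    congr 1
    have := Finset.card_le_univ v
    have := Finset.card_le_card hu.2
    omega

/-- The derivative of a configuration on the upper face `{ω : s ⊆ ω}`. -/
def upDeriv (τ : DCube k → A) (s : Finset (Fin k)) : A := altSum sᶜ fun t => τ (ind (s ∪ t))

theorem upDeriv_eq_sum (τ : DCube k → A) (s : Finset (Fin k)) :
    upDeriv τ s = ∑ v ∈ Finset.univ.filter (fun v => s ⊆ v),
      ((-1 : ℤ) ^ (v.card - s.card)) • τ (ind v) := by
  unfold upDeriv altSum
  refine Finset.sum_bij' (fun t _ => s ∪ t) (fun v _ => v \ s) ?_ ?_ ?_ ?_ ?_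
  · intro t _
    simp
  · intro v _
    rw [Finset.mem_powerset]
    intro j hj
    simpa using (Finset.mem_sdiff.1 hj).2
  · intro t ht
    have : Disjoint t s := Finset.disjoint_of_subset_left (Finset.mem_powerset.1 ht)
      disjoint_compl_left
    rw [Finset.union_sdiff_left, Finset.sdiff_eq_self_of_disjoint this]
  · intro v hv
    simp only [Finset.mem_filter, Finset.mem_univ, true_and] at hv
    exact Finset.union_sdiff_of_subset hv
  · intro t ht
    have : Disjoint s t := Finset.disjoint_of_subset_right (Finset.mem_powerset.1 ht)
      disjoint_compl_right
    rw [Finset.card_union_of_disjoint this, Nat.add_sub_cancel_left]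

/-- Möbius inversion: a configuration is determined by its derivatives on upper faces. -/
theorem sum_upDeriv (τ : DCube k → A) (s : Finset (Fin k)) :
    ∑ u ∈ Finset.univ.filter (fun u => s ⊆ u), upDeriv τ u = τ (ind s) := by
  simp only [upDeriv_eq_sum]
  simp only [Finset.sum_filter]
  have h1 : ∀ u : Finset (Fin k), (if s ⊆ u then ∑ v : Finset (Fin k),
      (if u ⊆ v then ((-1 : ℤ) ^ (v.card - u.card)) • τ (ind v) else 0) else 0) =
      ∑ v : Finset (Fin k), (if s ⊆ u ∧ u ⊆ v then ((-1 : ℤ) ^ (v.card - u.card)) else 0) •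
        τ (ind v) := by
    intro u
    by_cases h : s ⊆ u
    · simp only [h, if_true, true_and]
      refine Finset.sum_congr rfl fun v _ => ?_
      split_ifs <;> simp
    · simp [h]
  simp only [h1]
  rw [Finset.sum_comm]
  simp only [← Finset.sum_smul, ← Finset.sum_filter, sum_neg_one_pow_sub_right]
  simp

theorem upDeriv_of_eq_sum {τ : DCube k → A} {f : Finset (Fin k) → A}
    (hτ : ∀ s, τ (ind s) = ∑ u ∈ Finset.univ.filter (fun u => s ⊆ u), f u)
    (s : Finset (Fin k)) : upDeriv τ s = f s := by
  rw [upDeriv_eq_sum]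
  simp only [hτ]
  simp only [Finset.sum_filter]
  have h1 : ∀ v : Finset (Fin k), (if s ⊆ v then ((-1 : ℤ) ^ (v.card - s.card)) •
      ∑ u : Finset (Fin k), (if v ⊆ u then f u else 0) else 0) =
      ∑ u : Finset (Fin k), (if s ⊆ v ∧ v ⊆ u then ((-1 : ℤ) ^ (v.card - s.card)) else 0) •
        f u := by
    intro v
    by_cases h : s ⊆ v
    · simp only [h, if_true, true_and, Finset.smul_sum]
      refine Finset.sum_congr rfl fun u _ => ?_
      split_ifs <;> simp
    · simp [h]
  simp only [h1]
  rw [Finset.sum_comm]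
  simp only [← Finset.sum_smul, ← Finset.sum_filter, sum_neg_one_pow_sub_left]
  simp

theorem zCoeff_ind (r : ℕ) (v s : Finset (Fin k)) :
    zCoeff r (ind v) (ind s) =
      ∑ u : Finset (Fin k), if s ⊆ u ∧ u ⊆ v ∧ u.card ≤ r then (-1 : ℤ) ^ (v.card - u.card)
        else 0 := by
  unfold zCoeff
  rw [Finset.sum_filter, ← (indEquiv k).sum_comp]
  refine Finset.sum_congr rfl fun u _ => ?_
  change (if ind s ≤ ind u ∧ ind u ≤ ind v ∧ wt (ind u) ≤ r then
    (-1 : ℤ) ^ (wt (ind v) - wt (ind u)) else 0) = _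
  simp only [ind_le_ind, wt_ind]

/-- The normal form discards the derivatives on the upper faces of dimension less than `k - r`. -/
theorem normalForm_ind (r : ℕ) (τ : DCube k → A) (s : Finset (Fin k)) :
    normalForm r τ (ind s) = ∑ u ∈ Finset.univ.filter (fun u => s ⊆ u),
      if u.card ≤ r then upDeriv τ u else 0 := by
  unfold normalForm
  rw [← (indEquiv k).sum_comp]
  change ∑ v : Finset (Fin k), zCoeff r (ind v) (ind s) • τ (ind v) = _
  simp only [zCoeff_ind, Finset.sum_smul]
  rw [Finset.sum_comm, Finset.sum_filter]
  refine Finset.sum_congr rfl fun u _ => ?_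
  by_cases h1 : s ⊆ u <;> by_cases h2 : u.card ≤ r
  · simp only [h1, h2, and_true, true_and, if_true]
    rw [upDeriv_eq_sum, Finset.sum_filter]
    refine Finset.sum_congr rfl fun v _ => ?_
    split_ifs <;> simp
  all_goals simp [h1, h2]

theorem upDeriv_normalForm {r : ℕ} (τ : DCube k → A) {s : Finset (Fin k)} (hs : s.card ≤ r) :
    upDeriv (normalForm r τ) s = upDeriv τ s := by
  rw [upDeriv_of_eq_sum (normalForm_ind r τ) s, if_pos hs]

theorem normalForm_congr {r : ℕ} {τ τ' : DCube k → A}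
    (h : ∀ u : Finset (Fin k), u.card ≤ r → upDeriv τ u = upDeriv τ' u) :
    normalForm r τ = normalForm r τ' := by
  funext ω
  obtain ⟨s, rfl⟩ := exists_eq_ind ω
  rw [normalForm_ind, normalForm_ind]
  refine Finset.sum_congr rfl fun u _ => ?_
  split_ifs with hu
  · exact h u hu
  · rfl

theorem upDeriv_eq_zero_of_lt {r : ℕ} {τ : DCube k → A} (h : ∀ ω, r + 1 ≤ wt ω → τ ω = 0)
    {u : Finset (Fin k)} (hu : r < u.card) : upDeriv τ u = 0 := by
  rw [upDeriv_eq_sum]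
  refine Finset.sum_eq_zero fun v hv => ?_
  have := Finset.card_le_card (Finset.mem_filter.1 hv).2
  rw [h (ind v) (by rw [wt_ind]; omega), smul_zero]

theorem normalForm_eq_self {r : ℕ} {τ : DCube k → A} (h : ∀ ω, r + 1 ≤ wt ω → τ ω = 0) :
    normalForm r τ = τ := by
  funext ω
  obtain ⟨s, rfl⟩ := exists_eq_ind ω
  rw [normalForm_ind, ← sum_upDeriv τ s]
  refine Finset.sum_congr rfl fun u _ => ?_
  split_ifs with hu
  · rfl
  · rw [upDeriv_eq_zero_of_lt h (not_le.1 hu)]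

theorem upDeriv_eq_apply {r : ℕ} {τ : DCube k → A} (h : ∀ ω, r + 1 ≤ wt ω → τ ω = 0)
    {u : Finset (Fin k)} (hu : u.card = r) : upDeriv τ u = τ (ind u) := by
  unfold upDeriv
  rw [altSum_eq_empty_of_forall]
  · simp
  · intro t ht h0
    have : Disjoint u t := Finset.disjoint_of_subset_right ht disjoint_compl_right
    have h1 := Finset.card_union_of_disjoint this
    have h2 := Finset.card_pos.2 (Finset.nonempty_iff_ne_empty.2 h0)
    exact h _ (by rw [wt_ind]; omega)

theorem compl_eq_insert_compl_insert {i : Fin k} {s : Finset (Fin k)} (hi : i ∉ s) :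
    sᶜ = insert i (insert i s)ᶜ := by
  ext j
  by_cases hj : j = i
  · simp [hj, hi]
  · simp [hj]

theorem altSum_compl_insert {i : Fin k} {s : Finset (Fin k)} (hi : i ∉ s) (τ : DCube k → A) :
    altSum (insert i s)ᶜ (fun t => τ (ind (s ∪ t))) = upDeriv τ s + upDeriv τ (insert i s) := by
  unfold upDeriv
  rw [compl_eq_insert_compl_insert hi, altSum_insert (by simp)]
  simp only [Finset.union_insert, Finset.insert_union]
  abel

theorem upDeriv_glueConfig_insert {i : Fin k} {s : Finset (Fin k)} (hi : i ∉ s)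
    (b₀ b₁ : DCube k → A) : upDeriv (glueConfig i b₀ b₁) (insert i s) =
      upDeriv b₁ s + upDeriv b₁ (insert i s) := by
  rw [← altSum_compl_insert hi]
  refine altSum_congr fun t ht => ?_
  have hit : i ∉ t := fun e => by simpa using ht e
  have h1 : ind (insert i s ∪ t) i = true := by simp [ind]
  rw [glueConfig, if_pos h1]
  congr 1
  funext j
  by_cases hj : j = i
  · subst hj; simp [ind, hi, hit]
  · simp [ind, hj]

theorem upDeriv_glueConfig {i : Fin k} {s : Finset (Fin k)} (hi : i ∉ s)
    (b₀ b₁ : DCube k → A) : upDeriv (glueConfig i b₀ b₁) s =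
      (upDeriv b₀ s + upDeriv b₀ (insert i s)) - (upDeriv b₁ s + upDeriv b₁ (insert i s)) := by
  rw [← upDeriv_glueConfig_insert hi b₀ b₁, eq_sub_iff_add_eq, ← altSum_compl_insert hi,
    ← altSum_compl_insert hi]
  refine altSum_congr fun t ht => ?_
  have hit : i ∉ t := fun e => by simpa using ht e
  have h1 : ¬ ind (s ∪ t) i = true := by simp [ind, hi, hit]
  rw [glueConfig, if_neg h1]

theorem upDeriv_map {B : Type*} [AddCommGroup B] (φ : A →+ B) (τ : DCube k → A)
    (s : Finset (Fin k)) : upDeriv (fun ω => φ (τ ω)) s = φ (upDeriv τ s) :=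
  (altSum_map _ _ φ).symm

variable {H : Type*} [AddCommGroup H]

theorem cube_ind (x : H) (h : Fin k → H) (s : Finset (Fin k)) :
    cube x h (ind s) = x + dot s h := by
  simp [cube, ind, dot]

theorem upDeriv_comp_cube (lam : H → A) (x : H) (h : Fin k → H) (s : Finset (Fin k)) :
    upDeriv (fun ω => lam (cube x h ω)) s =
      altSum sᶜ fun t => lam (x + dot s h + dot t h) := by
  refine altSum_congr fun t ht => ?_
  change lam (cube x h (ind (s ∪ t))) = _
  rw [cube_ind]
  have : Disjoint s t := Finset.disjoint_of_subset_right ht disjoint_compl_right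
  rw [dot, Finset.sum_union this, ← add_assoc]
  rfl

theorem cubeDeriv_eq_altSum (lam : H → A) (x : H) (h : Fin k → H) :
    cubeDeriv lam (cube x h) = altSum Finset.univ fun t => lam (x + dot t h) := by
  unfold cubeDeriv altSum
  rw [← (indEquiv k).sum_comp, Finset.powerset_univ]
  refine Finset.sum_congr rfl fun t _ => ?_
  change ((-1 : ℤ) ^ wt (ind t)) • lam (cube x h (ind t)) = _
  rw [wt_ind, cube_ind]

end NormalForm

/-! ### Polynomial maps -/

section Polynomial

variable {ι κ H A : Type*} [AddCommGroup H] [AddCommGroup A]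

theorem altSum_map_finset (e : ι ↪ κ) (s : Finset ι) (f : Finset κ → A) :
    altSum (s.map e) f = altSum s fun t => f (t.map e) := by
  classical
  unfold altSum
  rw [Finset.map_eq_image, Finset.powerset_image, Finset.sum_image]
  · refine Finset.sum_congr rfl fun t _ => ?_
    simp [← Finset.map_eq_image]
  · intro a _ b _ h
    exact Finset.image_injective e.injective h

theorem dot_map (e : ι ↪ κ) (s : Finset ι) (a : κ → H) : dot (s.map e) a = dot s (a ∘ e) := by
  simp [dot]

/-- The vanishing of the iterated derivatives of a function in the coordinates `J` depends only on
the number of coordinates. -/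
theorem altSum_vertices_eq_zero_of_card_eq {p : H → A} {J : Finset ι} {L : Finset κ}
    (hcard : J.card = L.card)
    (hp : ∀ x (a : ι → H), altSum J (fun t => p (x + dot t a)) = 0) (x : H) (a : κ → H) :
    altSum L (fun t => p (x + dot t a)) = 0 := by
  classical
  let eJ : Fin L.card ↪ ι := (J.equivFinOfCardEq hcard).symm.toEmbedding.trans
    (Function.Embedding.subtype _)
  let eL : Fin L.card ↪ κ := L.equivFin.symm.toEmbedding.trans (Function.Embedding.subtype _)
  have hJ : Finset.univ.map eJ = J := by
    ext j
    simp only [eJ, Finset.mem_map, Finset.mem_univ, true_and]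
    constructor
    · rintro ⟨i, rfl⟩
      simp
    · intro hj
      exact ⟨J.equivFinOfCardEq hcard ⟨j, hj⟩, by simp⟩
  have hL : Finset.univ.map eL = L := by
    ext j
    simp only [eL, Finset.mem_map, Finset.mem_univ, true_and]
    constructor
    · rintro ⟨i, rfl⟩
      simp
    · intro hj
      exact ⟨L.equivFin ⟨j, hj⟩, by simp⟩
  have h1 := hp x (Function.extend eJ (a ∘ eL) 0)
  rw [← hJ, altSum_map_finset] at h1
  rw [← hL, altSum_map_finset, ← h1]
  refine altSum_congr fun t _ => ?_
  rw [dot_map, dot_map]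
  congr 3
  funext i
  simp [eJ.injective.extend_apply]

theorem altSum_vertices_eq_zero_of_card_le [DecidableEq κ] {p : H → A} {J : Finset ι}
    (hp : ∀ x (a : ι → H), altSum J (fun t => p (x + dot t a)) = 0) (n : ℕ) {L : Finset κ}
    (hcard : L.card = J.card + n) (x : H) (a : κ → H) :
    altSum L (fun t => p (x + dot t a)) = 0 := by
  induction n generalizing L x with
  | zero => exact altSum_vertices_eq_zero_of_card_eq hcard.symm hp x a
  | succ n ih =>
    obtain ⟨i, hi⟩ : L.Nonempty := Finset.card_pos.1 (by omega)
    have hc : (L.erase i).card = J.card + n := by rw [Finset.card_erase_of_mem hi]; omega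
    have hni := Finset.notMem_erase i L
    rw [← Finset.insert_erase hi, altSum_insert hni, ih hc, zero_sub, neg_eq_zero,
      ← ih hc (x + a i)]
    refine altSum_congr fun t ht => ?_
    rw [dot_insert (fun e => hni (ht e)), add_assoc]

theorem altSum_altSum [DecidableEq ι] (s : Finset ι) (f : Finset ι → A) :
    altSum s (fun t => altSum t f) = f s := by
  induction s using Finset.induction_on generalizing f with
  | empty => simp [altSum_empty]
  | insert i s hi ih =>
    rw [altSum_insert hi, ← altSum_sub, ← ih fun t => f (insert i t)]
    refine altSum_congr fun t ht => ?_
    rw [altSum_insert fun e => hi (ht e)]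
    abel

/-- The configurations in the Host–Kra group of the standard filtration are the cubes. -/
theorem exists_eq_cube_of_mem_hostKra {n : ℕ} {c : DCube n → H}
    (hc : c ∈ hostKra (stdFiltration H 1) n) : ∃ x h, c = cube x h := by
  induction hc using AddSubgroup.closure_induction with
  | mem f hf =>
    obtain ⟨i, g, η₀, η₁, hg, hle, hcodim, rfl⟩ := hf
    obtain ⟨a, rfl⟩ := exists_eq_ind η₀
    obtain ⟨b, rfl⟩ := exists_eq_ind η₁
    rw [ind_le_ind] at hle
    rw [wt_ind, wt_ind] at hcodim
    have hb : b.card ≤ n := by simpa using Finset.card_le_univ b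
    suffices h : ∃ x h, ∀ t : Finset (Fin n), (if a ⊆ t ∧ t ⊆ b then g else 0) = x + dot t h by
      obtain ⟨x, h, hh⟩ := h
      refine ⟨x, h, ?_⟩
      funext ω
      obtain ⟨t, rfl⟩ := exists_eq_ind ω
      rw [cube_ind, ← hh t]
      simp only [ind_le_ind]
    by_cases hi : i ≤ 1
    · by_cases hbn : b.card = n
      · have hbu : b = Finset.univ := Finset.eq_univ_of_card b (by simpa using hbn)
        have ha : a.card ≤ 1 := by omega
        rcases Nat.le_one_iff_eq_zero_or_eq_one.1 ha with ha | ha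
        · rw [Finset.card_eq_zero] at ha
          subst ha
          exact ⟨g, 0, fun t => by simp [hbu, dot]⟩
        · obtain ⟨j, rfl⟩ := Finset.card_eq_one.1 ha
          refine ⟨0, Pi.single j g, fun t => ?_⟩
          simp [hbu, dot]
      · have ha : a = ∅ := Finset.card_eq_zero.1 (by omega)
        obtain ⟨j, hj⟩ : ∃ j, bᶜ = {j} := Finset.card_eq_one.1 (by
          rw [Finset.card_compl, Fintype.card_fin]; omega)
        refine ⟨g, Pi.single j (-g), fun t => ?_⟩
        have h1 : t ⊆ b ↔ j ∉ t := by
          rw [← compl_compl b, hj, Finset.subset_compl_comm, Finset.singleton_subset_iff,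
            Finset.mem_compl]
        by_cases h2 : j ∈ t <;> simp [ha, dot, h1, h2]
    · have : g = 0 := by simpa [stdFiltration, hi] using hg
      exact ⟨0, 0, fun t => by simp [this, dot]⟩
  | zero => exact ⟨0, 0, by funext ω; simp [cube]⟩
  | add f g _ _ hf hg =>
    obtain ⟨x, h, rfl⟩ := hf
    obtain ⟨x', h', rfl⟩ := hg
    refine ⟨x + x', h + h', ?_⟩
    funext ω
    obtain ⟨t, rfl⟩ := exists_eq_ind ω
    simp only [Pi.add_apply, cube_ind, dot, Finset.sum_add_distrib]
    abel
  | neg f _ hf =>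
    obtain ⟨x, h, rfl⟩ := hf
    refine ⟨-x, -h, ?_⟩
    funext ω
    obtain ⟨t, rfl⟩ := exists_eq_ind ω
    simp only [Pi.neg_apply, cube_ind, dot, Finset.sum_neg_distrib]
    abel

/-- A function whose iterated derivatives of order `s + 1` vanish is a polynomial map of
degree `s`. -/
theorem isPolyMap_of_altSum_eq_zero {p : H → A} {J : Finset ι} {s : ℕ} (hJ : J.card = s + 1)
    (hp : ∀ x (a : ι → H), altSum J (fun t => p (x + dot t a)) = 0) : IsPolyMap s p := by
  intro n c hc
  obtain ⟨x, h, rfl⟩ := exists_eq_cube_of_mem_hostKra hc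
  -- Expand the configuration in indicators of upper faces.
  have h1 : (fun ω => p (cube x h ω)) = ∑ η : Finset (Fin n), fun ω : DCube n =>
      if ind η ≤ ω ∧ ω ≤ ind Finset.univ then
        ((-1 : ℤ) ^ η.card) • altSum η (fun t => p (x + dot t h)) else 0 := by
    funext ω
    obtain ⟨t, rfl⟩ := exists_eq_ind ω
    rw [Finset.sum_apply, cube_ind, ← altSum_altSum t (fun t => p (x + dot t h))]
    simp only [ind_le_ind, Finset.subset_univ, and_true]
    rw [← Finset.sum_filter]
    unfold altSum
    refine Finset.sum_congr ?_ fun _ _ => rfl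
    ext; simp
  rw [h1]
  refine AddSubgroup.sum_mem _ fun η _ => ?_
  by_cases hη : η.card ≤ s
  · refine AddSubgroup.subset_closure ⟨s, _, ind η, ind Finset.univ, ?_, ?_, ?_, rfl⟩
    · simp [stdFiltration]
    · exact ind_le_ind.2 (Finset.subset_univ _)
    · rw [wt_ind, wt_ind, Finset.card_univ, Fintype.card_fin]
      omega
  · obtain ⟨m, hm⟩ : ∃ m, η.card = J.card + m := ⟨η.card - J.card, by omega⟩
    rw [altSum_vertices_eq_zero_of_card_le hp m hm x h]
    simp only [smul_zero, ite_self]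
    exact AddSubgroup.zero_mem _

end Polynomial

/-! ### Cubes of a system -/

theorem prob_not {Ω : Type*} [Fintype Ω] [Nonempty Ω] (p : Ω → Prop) :
    prob (fun a => ¬ p a) = 1 - prob p := by
  classical
  have h : prob p + prob (fun a => ¬ p a) = 1 := by
    unfold prob
    rw [← add_div, ← Finset.sum_add_distrib, div_eq_one_iff_eq (by positivity)]
    rw [Finset.sum_congr rfl (g := fun _ => (1 : ℝ)) fun a _ => by by_cases h : p a <;> simp [h]]
    simp
  linarith

section Bridge

variable {k : ℕ} {H : Type*} [AddCommGroup H]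

theorem dot_update_of_notMem {i : Fin k} {s : Finset (Fin k)} (hi : i ∉ s) (h : Fin k → H)
    (g : H) : dot s (Function.update h i g) = dot s h :=
  dot_congr fun j hj => by
    have : j ≠ i := fun e => hi (e ▸ hj)
    simp [this]

theorem dot_update_of_mem {i : Fin k} {s : Finset (Fin k)} (hi : i ∈ s) (h : Fin k → H)
    (g : H) : dot s (Function.update h i g) = dot s h - h i + g := by
  rw [← Finset.insert_erase hi, dot_insert (Finset.notMem_erase i s),
    dot_insert (Finset.notMem_erase i s), dot_update_of_notMem (Finset.notMem_erase i s)]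
  simp
  abel

theorem cube_reflect (x : H) (h : Fin k → H) (i : Fin k) :
    (fun ω : DCube k => cube x h (Function.update ω i (!(ω i)))) =
      cube (x + h i) (Function.update h i (-h i)) := by
  funext ω
  obtain ⟨t, rfl⟩ := exists_eq_ind ω
  by_cases hi : i ∈ t
  · have h1 : Function.update (ind t) i (!(ind t i)) = ind (t.erase i) := by
      funext j
      by_cases hj : j = i
      · subst hj; simp [ind, hi]
      · simp [ind, hj]
    rw [h1, cube_ind, cube_ind, dot_update_of_mem hi, ← Finset.insert_erase hi,
      dot_insert (Finset.notMem_erase i t), Finset.erase_insert (Finset.notMem_erase i t)]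
    abel
  · have h1 : Function.update (ind t) i (!(ind t i)) = ind (insert i t) := by
      funext j
      by_cases hj : j = i
      · subst hj; simp [ind, hi]
      · simp [ind, hj]
    rw [h1, cube_ind, cube_ind, dot_update_of_notMem hi, dot_insert hi]
    abel

theorem joinLast_cube (x : H) (h : Fin k → H) (g : H) :
    joinLast (cube x h) (fun ω => cube x h ω + g) =
      cube x (Fin.snoc h g : Fin (k + 1) → H) := by
  funext ω
  unfold joinLast cube
  rw [Fin.sum_univ_castSucc]
  simp only [Fin.snoc_castSucc, Fin.snoc_last, Fin.init]
  split_ifs <;> simp only [add_assoc, add_zero] <;> rfl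

theorem cube_injective {x x' : H} {h h' : Fin k → H} (heq : cube x h = cube x' h') :
    x = x' ∧ h = h' := by
  have h1 : ∀ s : Finset (Fin k), x + dot s h = x' + dot s h' := fun s => by
    rw [← cube_ind, ← cube_ind, heq]
  have h2 : x = x' := by simpa [dot_empty] using h1 ∅
  refine ⟨h2, funext fun j => ?_⟩
  simpa [dot, h2] using h1 {j}

theorem glueConfig_comp_cube {B : Type*} (lam : H → B) (x : H) (h : Fin k → H) (g : H)
    (i : Fin k) : (fun ω => lam (cube x h ω)) = glueConfig i
      (fun ω => lam (cube x (Function.update h i (h i + g)) ω))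
      (fun ω => lam (cube (x + h i) (Function.update h i g) ω)) := by
  funext ω
  obtain ⟨t, rfl⟩ := exists_eq_ind ω
  by_cases hi : i ∈ t
  · have h1 : Function.update (ind t) i false = ind (t.erase i) := by
      funext j
      by_cases hj : j = i
      · subst hj; simp [ind]
      · simp [ind, hj]
    have h2 : ind t i = true := by simp [ind, hi]
    rw [glueConfig, if_pos h2, h1, cube_ind, cube_ind,
      dot_update_of_notMem (Finset.notMem_erase i t), ← Finset.insert_erase hi,
      dot_insert (Finset.notMem_erase i t), Finset.erase_insert (Finset.notMem_erase i t),
      add_assoc]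
  · have h2 : ¬ ind t i = true := by simp [ind, hi]
    rw [glueConfig, if_neg h2, cube_ind, cube_ind, dot_update_of_notMem hi]

variable [Fintype H]

/-- A set of cubes that is closed under reflections and in which, for each cube and each
coordinate, all but a proportion `ε` of the choices for that coordinate give another element. -/
structure IsPopular (S : Set (DCube k → H)) (ε : ℝ) : Prop where
  popular : ∀ x h i, cube x h ∈ S →
    prob (fun g => ¬ cube x (Function.update h i g) ∈ S) ≤ ε
  reflect : ∀ x h i, cube x h ∈ S → cube (x + h i) (Function.update h i (-h i)) ∈ S

theorem IsCubeSystem.isPopular {ε : ℝ} {S : (j : ℕ) → Set (DCube j → H)}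
    (hS : IsCubeSystem k (1 - ε) S) : IsPopular (S k) ε where
  reflect x h i hc := by
    rw [← cube_reflect]
    exact hS.reflect k le_rfl _ hc i
  popular x h i hc := by
    classical
    obtain _ | n := k
    · exact i.elim0
    have h1 : cube x (h ∘ i.succAbove) ∈ S n := by
      have := hS.face (n + 1) (by omega) le_rfl _ hc n i.succAboveOrderEmb (fun _ => false)
      convert this using 1
      funext ω
      unfold cube faceMap
      rw [Fin.sum_univ_succAbove _ i]
      have h3 : ∀ j, Function.extend i.succAboveOrderEmb ω (fun _ => false) (i.succAbove j) =
          ω j := fun j => i.succAboveOrderEmb.injective.extend_apply ω _ j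
      simp [h3]
    have h2 := hS.popular n (by omega) _ h1
    have h3 : {g : H | joinLast (cube x (h ∘ i.succAbove))
        (fun ω => cube x (h ∘ i.succAbove) ω + g) ∈ S (n + 1)}.ncard ≤
        {g : H | cube x (Function.update h i g) ∈ S (n + 1)}.ncard := by
      refine Set.ncard_le_ncard ?_ (Set.toFinite _)
      intro g hg
      replace hg : joinLast _ _ ∈ S (n + 1) := hg
      rw [joinLast_cube] at hg
      -- the permutation that moves the last coordinate to position `i`
      let π : Equiv.Perm (Fin (n + 1)) := finSuccEquivLast.trans (finSuccEquiv' i).symm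
      have h4 := hS.perm (n + 1) le_rfl _ hg π
      have h5 : (fun ω : DCube (n + 1) =>
          cube x (Fin.snoc (h ∘ i.succAbove) g : Fin (n + 1) → H) (ω ∘ π)) =
          cube x (Function.update h i g) := by
        funext ω
        unfold cube
        rw [Fin.sum_univ_castSucc, Fin.sum_univ_succAbove _ i]
        have h6 : π (Fin.last n) = i := by simp [π]
        have h7 : ∀ j : Fin n, π j.castSucc = i.succAbove j := fun j => by simp [π]
        simp [h6, h7, add_comm]
      rwa [h5] at h4
    have h4 := h2.trans (Nat.cast_le.2 h3)
    rw [ncard_eq_prob_mul, Nat.card_eq_fintype_card] at h4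
    have h5 := le_of_mul_le_mul_right h4 (by positivity)
    rw [prob_not]
    linarith

namespace IsPopular

variable {S : Set (DCube k → H)} {ε : ℝ}

/-- Moving the lower instead of the upper face of a cube. -/
theorem popular_lower (hS : IsPopular S ε) (x : H) (h : Fin k → H) (i : Fin k)
    (hc : cube x h ∈ S) :
    prob (fun g => ¬ cube (x + h i - g) (Function.update h i g) ∈ S) ≤ ε := by
  have h1 := hS.popular _ _ i (hS.reflect x h i hc)
  rw [← prob_comp_equiv (Equiv.neg H)] at h1
  refine (prob_mono fun g hg hg' => hg ?_).trans h1
  have := hS.reflect _ _ i hg'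
  simpa [sub_eq_add_neg] using this

theorem prob_neighbours_le (hS : IsPopular S ε) (hε : 0 ≤ ε) (s : Finset (Fin k)) (i : Fin k)
    (u : H) (h : Fin k → H) (hc : cube (u - dot s h) h ∈ S) :
    prob (fun g => ¬ Neighbours sᶜ (fun u h => cube (u - dot s h) h ∈ S) i u h g) ≤ 2 * ε := by
  by_cases hi : i ∈ s
  · refine (prob_mono fun g hg hg' => hg ⟨?_, fun h => absurd hi (by simpa using h)⟩).trans
      ((hS.popular_lower _ _ i hc).trans (by linarith))
    change cube (u - dot s (Function.update h i g)) _ ∈ S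
    rw [dot_update_of_mem hi]
    convert hg' using 2
    abel
  · rw [two_mul]
    have h1 := hS.popular _ _ i hc
    have h2 := hS.popular _ _ i (hS.reflect _ _ i hc)
    rw [← prob_sub_right (h i)] at h2
    refine (prob_mono fun g hg => ?_).trans ((prob_or_le _ _).trans (add_le_add h1 h2))
    by_contra hcon
    simp only [not_or, not_not, Function.update_idem] at hcon
    refine hg ⟨?_, fun _ => ?_⟩
    · change cube (u - dot s (Function.update h i g)) _ ∈ S
      rw [dot_update_of_notMem hi]; exact hcon.1
    · change cube (u + h i - dot s (Function.update h i (g - h i))) _ ∈ S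
      rw [dot_update_of_notMem hi, add_sub_right_comm]; exact hcon.2

theorem isPartialCocycle_zero (hS : IsPopular S ε) (hε : 0 ≤ ε) :
    IsPartialCocycle Finset.univ (fun x h => cube x h ∈ S) (fun _ _ => (0 : ℤ)) (2 * ε) 0 where
  near i x h hG := by
    simpa [dot_empty] using hS.prob_neighbours_le hε ∅ i x h (by simpa [dot_empty] using hG)
  glued i := by
    refine le_of_eq (Eq.trans ?_ (prob_false (Ω := H × (Fin k → H) × H)))
    congr 1
    funext z
    simp [Glued]

end IsPopular

/-- A bound for the number of exceptional glued triples is a bound for a probability. -/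
theorem prob_gluedTriples_le {δ : ℝ} (i : Fin k)
    (p : (DCube k → H) × (DCube k → H) × (DCube k → H) → Prop)
    (hp : (({t ∈ gluedTriples H k i | p t}.ncard : ℕ) : ℝ) ≤ δ * (Nat.card H : ℝ) ^ (k + 2)) :
    prob (fun z : H × (Fin k → H) × H =>
      p (cube z.1 (Function.update z.2.1 i (z.2.1 i + z.2.2)),
        cube (z.1 + z.2.1 i) (Function.update z.2.1 i z.2.2), cube z.1 z.2.1)) ≤ δ := by
  classical
  set Φ : H × (Fin k → H) × H → (DCube k → H) × (DCube k → H) × (DCube k → H) := fun z =>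
    (cube z.1 (Function.update z.2.1 i (z.2.1 i + z.2.2)),
        cube (z.1 + z.2.1 i) (Function.update z.2.1 i z.2.2), cube z.1 z.2.1) with hΦ
  have h1 : {z | p (Φ z)}.ncard ≤ {t ∈ gluedTriples H k i | p t}.ncard := by
    refine Set.ncard_le_ncard_of_injOn Φ ?_ ?_ (Set.toFinite _)
    · intro z hz
      exact ⟨⟨z.1, z.2.1, z.2.2, rfl, rfl, rfl⟩, hz⟩
    · rintro ⟨x, h, g⟩ _ ⟨x', h', g'⟩ _ heq
      simp only [hΦ, Prod.mk.injEq] at heq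
      obtain ⟨h1, h2⟩ := cube_injective heq.2.2
      obtain ⟨-, h3⟩ := cube_injective heq.2.1
      have h4 := congrFun h3 i
      simp only [Function.update_self] at h4
      rw [h1, h2, h4]
  have h2 : ((({z | p (Φ z)}).ncard : ℕ) : ℝ) ≤ δ * (Nat.card H : ℝ) ^ (k + 2) :=
    (Nat.cast_le.2 h1).trans hp
  rw [ncard_eq_prob_mul] at h2
  have h3 : (Fintype.card (H × (Fin k → H) × H) : ℝ) = (Nat.card H : ℝ) ^ (k + 2) := by
    rw [Nat.card_eq_fintype_card]
    simp only [Fintype.card_prod, Fintype.card_fun, Fintype.card_fin]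
    push_cast
    ring
  rw [h3] at h2
  have : 0 < (Nat.card H : ℝ) ^ (k + 2) := by
    rw [Nat.card_eq_fintype_card]; positivity
  exact le_of_mul_le_mul_right h2 this

end Bridge

/-! ### Generalized cocycles -/

section GenCocycle

variable {k : ℕ} {H : Type*} [AddCommGroup H] [Fintype H] {d r : ℕ} {ε δ : ℝ}
  {S : Set (DCube k → H)} {ρ : (DCube k → H) → DCube k → (Fin d → ℤ)}

/-- The glueing relation of a generalized cocycle, in terms of derivatives on upper faces. -/
theorem IsGenCocycle.prob_glue_le (hρ : IsGenCocycle r δ S ρ) (i : Fin k) :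
    prob (fun z : H × (Fin k → H) × H =>
      cube z.1 (Function.update z.2.1 i (z.2.1 i + z.2.2)) ∈ S ∧
      cube (z.1 + z.2.1 i) (Function.update z.2.1 i z.2.2) ∈ S ∧ cube z.1 z.2.1 ∈ S ∧
      ¬ ∀ s : Finset (Fin k), s.card ≤ r → upDeriv (ρ (cube z.1 z.2.1)) s =
        upDeriv (glueConfig i (ρ (cube z.1 (Function.update z.2.1 i (z.2.1 i + z.2.2))))
          (ρ (cube (z.1 + z.2.1 i) (Function.update z.2.1 i z.2.2)))) s) ≤ δ := by
  refine (prob_mono ?_).trans (prob_gluedTriples_le i _ (hρ.glue i))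
  rintro z ⟨h0, h1, h2, h3⟩
  refine ⟨h0, h1, h2, fun h4 => h3 fun s hs => ?_⟩
  rw [← upDeriv_normalForm (glueConfig i _ _) hs]
  congr 1
  exact funext h4

open Classical in
/-- On the upper faces of dimension `k - r`, a generalized cocycle of type `r` restricts to a
partial cocycle in the ordinary sense. Cubes are given here by the vertex `u` over `s`. -/
theorem IsGenCocycle.isPartialCocycle (hρ : IsGenCocycle r δ S ρ) (hS : IsPopular S ε)
    (hε : 0 ≤ ε) {s : Finset (Fin k)} (hs : s.card = r) :
    IsPartialCocycle sᶜ (fun u h => cube (u - dot s h) h ∈ S)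
      (fun u h => if cube (u - dot s h) h ∈ S then upDeriv (ρ (cube (u - dot s h) h)) s else 0)
      (2 * ε) δ where
  near i u h hG := hS.prob_neighbours_le hε s i u h hG
  glued i := by
    by_cases hi : i ∈ s
    · rw [← prob_comp_affine (fun z : H × (Fin k → H) × H =>
        (z.1 + dot s z.2.1 + z.2.2, Function.update z.2.1 i (z.2.1 i + z.2.2), z.2.2)) ?_ ?_]
      · have hw : ind s i = true := by simp [ind, hi]
        refine (prob_mono ?_).trans (prob_gluedTriples_le i _ (hρ.upper (ind s) i hw))
        rintro ⟨x, h, g⟩ ⟨h0, ⟨h1, -⟩, h2⟩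
        have e0 : x + dot s h + g - dot s (Function.update h i (h i + g)) = x := by
          rw [dot_update_of_mem hi]; abel
        have e1 : x + dot s h + g - dot s (Function.update h i g) = x + h i := by
          rw [dot_update_of_mem hi]; abel
        have hic : i ∉ sᶜ := by simpa using hi
        simp only [e0, e1, Function.update_idem] at h0 h1
        simp only [Glued, e0, e1, Function.update_idem, h0, h1, if_true, if_neg hic, sub_zero]
          at h2
        rw [upDeriv_eq_apply (hρ.normal _ h0) hs, upDeriv_eq_apply (hρ.normal _ h1) hs] at h2
        exact ⟨h0, h1, h2⟩
      · rintro ⟨x, h, g⟩ ⟨x', h', g'⟩ ⟨x'', h'', g''⟩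
        refine Prod.ext ?_ (Prod.ext ?_ rfl)
        · simp only [dot, Prod.fst_add, Prod.fst_sub, Prod.snd_add, Prod.snd_sub, Pi.add_apply,
            Pi.sub_apply, Finset.sum_add_distrib, Finset.sum_sub_distrib]
          abel
        · funext j
          by_cases hj : j = i
          · subst hj
            simp only [Prod.fst_add, Prod.fst_sub, Prod.snd_add, Prod.snd_sub, Pi.add_apply,
              Pi.sub_apply, Function.update_self]
            abel
          · simp [hj]
      · rintro ⟨u, h, g⟩
        refine ⟨(u - dot s (Function.update h i (h i - g)) - g,
          Function.update h i (h i - g), g), ?_⟩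
        refine Prod.ext ?_ (Prod.ext (by simp) rfl)
        have h1 : ∀ D : H, u - D - g + D + g = u := fun D => by abel
        exact h1 _
    · rw [← prob_comp_affine (fun z : H × (Fin k → H) × H =>
        (z.1 + dot s z.2.1, z.2.1, z.2.1 i + z.2.2)) ?_ ?_]
      · refine (prob_mono ?_).trans (hρ.prob_glue_le i)
        rintro ⟨x, h, g⟩ ⟨h0, ⟨h1, h1'⟩, h2⟩
        have hic : i ∈ sᶜ := by simpa using hi
        have h3 := h1' hic
        have e0 : x + dot s h - dot s h = x := by abel
        have e1 : x + dot s h - dot s (Function.update h i (h i + g)) = x := by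
          rw [dot_update_of_notMem hi]; abel
        have e2 : x + dot s h + h i - dot s (Function.update h i g) = x + h i := by
          rw [dot_update_of_notMem hi]; abel
        simp only [e0, e1, e2, add_sub_cancel_left] at h0 h1 h3
        simp only [Glued, e0, e1, e2, add_sub_cancel_left, h0, h1, h3, if_true, if_pos hic] at h2
        refine ⟨h1, h3, h0, fun h4 => h2 ?_⟩
        have hlt : r < (insert i s).card := by rw [Finset.card_insert_of_notMem hi]; omega
        rw [h4 s hs.le, upDeriv_glueConfig hi, upDeriv_eq_zero_of_lt (hρ.normal _ h1) hlt,
          upDeriv_eq_zero_of_lt (hρ.normal _ h3) hlt, add_zero, add_zero]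
      · rintro ⟨x, h, g⟩ ⟨x', h', g'⟩ ⟨x'', h'', g''⟩
        refine Prod.ext ?_ (Prod.ext rfl ?_)
        · simp only [dot, Prod.fst_add, Prod.fst_sub, Prod.snd_add, Prod.snd_sub, Pi.add_apply,
            Pi.sub_apply, Finset.sum_add_distrib, Finset.sum_sub_distrib]
          abel
        · simp only [Prod.fst_add, Prod.fst_sub, Prod.snd_add, Prod.snd_sub, Pi.add_apply,
            Pi.sub_apply]
          abel
      · rintro ⟨u, h, g⟩
        exact ⟨(u - dot s h, h, g - h i), by simp⟩

/-- The cube `(x; h)` lies in `S`, and the derivative of `lam` on its upper face over `s` is not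
the one prescribed by `ρ`. -/
def Mismatch (S : Set (DCube k → H)) (ρ : (DCube k → H) → DCube k → (Fin d → ℤ))
    (lam : H → Fin d → ℝ) (s : Finset (Fin k)) (z : H × (Fin k → H)) : Prop :=
  cube z.1 z.2 ∈ S ∧ upDeriv (fun ω => lam (cube z.1 z.2 ω)) s ≠
    fun j => (upDeriv (ρ (cube z.1 z.2)) s j : ℝ)

/-- For every set `s` of size `r` there is a potential for the derivatives over `s`. -/
theorem IsGenCocycle.exists_potential (hρ : IsGenCocycle r δ S ρ) (hS : IsPopular S ε)
    (hSne : S.Nonempty) (hSc : S ⊆ cubes k H) (hε0 : 0 ≤ ε) (hδ0 : 0 ≤ δ) (hr : r < k)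
    (hε : 64 * (2 ^ k) ^ 4 * ε ≤ 1) (hδ : 8 * (2 ^ k) ^ 4 * δ ≤ 1)
    {R : ℝ} (hR0 : 0 ≤ R) (hR : ∀ c ∈ S, ∀ ω, ∑ j, |(ρ c ω j : ℝ)| ≤ R)
    {s : Finset (Fin k)} (hs : s.card = r) :
    ∃ lam : H → Fin d → ℝ,
      (∀ x a, ∃ z : Fin d → ℤ, altSum sᶜ (fun ω => lam (x + dot ω a)) = fun j => (z j : ℝ)) ∧
      (∀ x, ∑ j, |lam x j| ≤ 2 * (2 ^ k) ^ 2 * R) ∧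
      prob (Mismatch S ρ lam s) ≤ 12 * (2 ^ k) ^ 4 * δ := by
  classical
  have hσ := hρ.isPartialCocycle hS hε0 hs
  have hJ : (sᶜ).Nonempty := by
    rw [← Finset.card_pos, Finset.card_compl, Fintype.card_fin]; omega
  have hG : ∃ (u : H) (h : Fin k → H), cube (u - dot s h) h ∈ S := by
    obtain ⟨c, hc⟩ := hSne
    obtain ⟨x, h, rfl⟩ := hSc hc
    exact ⟨x + dot s h, h, by simpa using hc⟩
  obtain ⟨κ, hκ, hκN, hκσ⟩ := hσ.exists_exact hJ hG (by positivity) hδ0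
    (by rw [Fintype.card_fin]; linarith) (by rw [Fintype.card_fin]; exact hδ)
    (l1Seminorm d) hR0 (fun u h => by
      by_cases hc : cube (u - dot s h) h ∈ S
      · rw [if_pos hc, upDeriv_eq_apply (hρ.normal _ hc) hs]
        exact hR _ hc _
      · rw [if_neg hc, map_zero]; exact hR0)
  rw [Fintype.card_fin] at hκσ
  obtain ⟨lam, hlam, hlamN⟩ := exists_potential_of_exact hκ hκN
  refine ⟨lam, fun x a => ⟨_, hlam x a⟩, fun x => ?_, ?_⟩
  · simpa only [Fintype.card_fin] using hlamN x
  · rw [← prob_comp_affine (fun z : H × (Fin k → H) => (z.1 + dot s z.2, z.2)) ?_ ?_] at hκσ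
    · refine (prob_mono ?_).trans hκσ
      rintro ⟨x, h⟩ ⟨hc, hne⟩
      have e : x + dot s h - dot s h = x := by abel
      refine ⟨by simpa only [e] using hc, fun heq => hne ?_⟩
      simp only [e] at heq
      rw [if_pos hc] at heq
      rw [upDeriv_comp_cube, hlam, heq]
    · rintro ⟨x, h⟩ ⟨x', h'⟩ ⟨x'', h''⟩
      refine Prod.ext ?_ rfl
      simp only [dot, Prod.fst_add, Prod.fst_sub, Prod.snd_add, Prod.snd_sub, Pi.add_apply,
        Pi.sub_apply, Finset.sum_add_distrib, Finset.sum_sub_distrib]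
      abel
    · rintro ⟨u, h⟩
      exact ⟨(u - dot s h, h), by simp⟩

/-- The derivatives of `ρ` over `insert i s` determine those over `s`, by glueing. Hence a
potential that is correct over `insert i s` is correct over `s`. -/
theorem IsGenCocycle.prob_mismatch_le_insert (hρ : IsGenCocycle r δ S ρ) (hS : IsPopular S ε)
    (hε : 4 * ε ≤ 1) (lam : H → Fin d → ℝ) {s : Finset (Fin k)} {i : Fin k} (hi : i ∉ s)
    (hs : (insert i s).card ≤ r) :
    prob (Mismatch S ρ lam s) ≤ 2 * δ + 4 * prob (Mismatch S ρ lam (insert i s)) := by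
  -- The cube `(y; p)` is the upper cube `c₁` of a glued triple, `g` its free parameter.
  let F : H × (Fin k → H) × H → Prop := fun z =>
    cube z.1 (Function.update z.2.1 i (z.2.1 i + z.2.2)) ∈ S ∧
      cube (z.1 + z.2.1 i) (Function.update z.2.1 i z.2.2) ∈ S ∧ cube z.1 z.2.1 ∈ S ∧
      ¬ ∀ s : Finset (Fin k), s.card ≤ r → upDeriv (ρ (cube z.1 z.2.1)) s =
        upDeriv (glueConfig i (ρ (cube z.1 (Function.update z.2.1 i (z.2.1 i + z.2.2))))
          (ρ (cube (z.1 + z.2.1 i) (Function.update z.2.1 i z.2.2)))) s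
  let T : (H × (Fin k → H)) × H → H × (Fin k → H) × H := fun z =>
    (z.1.1 - z.2, Function.update z.1.2 i z.2, z.1.2 i)
  have hTaff : ∀ a b c, T (a - b + c) = T a - T b + T c := by
    rintro ⟨⟨y, p⟩, g⟩ ⟨⟨y', p'⟩, g'⟩ ⟨⟨y'', p''⟩, g''⟩
    refine Prod.ext ?_ (Prod.ext ?_ rfl)
    · simp only [T, Prod.fst_add, Prod.fst_sub, Prod.snd_add, Prod.snd_sub]
      abel
    · funext j
      by_cases hj : j = i
      · subst hj; simp [T]
      · simp [T, hj]
  have hTsurj : Function.Surjective T := by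
    rintro ⟨x, h, g⟩
    exact ⟨((x + h i, Function.update h i g), h i), by simp [T]⟩
  let W : (H × (Fin k → H)) × H → Prop := fun z => F (T z) ∨
    (Mismatch S ρ lam (insert i s) ((T z).1, (T z).2.1) ∨ Mismatch S ρ lam (insert i s) z.1)
  have hW : prob W ≤ δ + 2 * prob (Mismatch S ρ lam (insert i s)) := by
    rw [two_mul]
    refine (prob_or_le _ _).trans (add_le_add ?_ ((prob_or_le _ _).trans (add_le_add ?_ ?_)))
    · rw [prob_comp_affine T hTaff hTsurj F]
      exact hρ.prob_glue_le i
    · rw [prob_comp_affine T hTaff hTsurj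
        (fun z => Mismatch S ρ lam (insert i s) (z.1, z.2.1))]
      exact (prob_comp_affine (fun z : H × (Fin k → H) × H => (z.1, z.2.1))
        (fun _ _ _ => rfl) (fun z => ⟨(z.1, z.2, 0), rfl⟩) (Mismatch S ρ lam (insert i s))).le
    · exact (prob_comp_affine (Prod.fst : (H × (Fin k → H)) × H → H × (Fin k → H))
        (fun _ _ _ => rfl) Prod.fst_surjective (Mismatch S ρ lam (insert i s))).le
  have h1 : prob (Mismatch S ρ lam s) ≤ prob (fun z => 1 / 2 ≤ prob (fun g => W (z, g))) := by
    refine prob_mono ?_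
    rintro ⟨y, p⟩ ⟨hc, hne⟩
    have h3 : prob (fun g => ¬ cube (y - g) (Function.update p i g) ∈ S) ≤ ε := by
      have h4 := hS.popular _ _ i (hS.reflect y p i hc)
      have h5 := hS.popular y p i hc
      rw [← prob_comp_equiv (Equiv.neg H)] at h5
      refine (prob_mono fun g hg hg' => hg ?_).trans h5
      have := hS.reflect _ _ i hg'
      simpa [sub_eq_add_neg] using this
    have h4 : prob (fun g => ¬ cube (y - g) (Function.update p i (g + p i)) ∈ S) ≤ ε := by
      have h5 := hS.popular_lower y p i hc
      rw [← prob_comp_equiv (Equiv.addRight (p i))] at h5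
      refine (prob_mono fun g hg hg' => hg ?_).trans h5
      simpa using hg'
    have h5 : prob (fun g => ¬ W ((y, p), g)) ≤ 1 / 2 := by
      refine (prob_mono fun g hg => ?_).trans ((prob_or_le _ _).trans
        ((add_le_add h3 h4).trans (by linarith)))
      by_contra hcon
      simp only [not_or, not_not] at hcon
      simp only [W, not_or, F, T, Mismatch, Function.update_self, Function.update_idem,
        not_and, not_not, sub_add_cancel, Function.update_eq_self, ne_eq] at hg
      obtain ⟨hg1, hg2, hg3⟩ := hg
      have e0 := hg1 hcon.2 hc hcon.1 (insert i s) hs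
      have e1 := hg2 hcon.1
      have e2 := hg3 hc
      refine hne ?_
      have e3 := glueConfig_comp_cube lam (y - g) (Function.update p i g) (p i) i
      simp only [Function.update_self, Function.update_idem, sub_add_cancel,
        Function.update_eq_self] at e3
      rw [e3, upDeriv_glueConfig_insert hi, e2, e0, upDeriv_glueConfig_insert hi] at e1
      funext j
      have := congrFun e1 j
      simp only [Pi.add_apply, Int.cast_add] at this
      simpa using this
    rw [prob_not] at h5
    change 1 / 2 ≤ prob (fun g => W ((y, p), g))
    linarith
  have h2 := mul_prob_section_le W (1 / 2)
  linarith

/-- A potential that is correct over `s` is correct over all subsets of `s`. -/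
theorem IsGenCocycle.prob_mismatch_le_of_subset (hρ : IsGenCocycle r δ S ρ)
    (hS : IsPopular S ε) (hε : 4 * ε ≤ 1) (lam : H → Fin d → ℝ) {β : ℝ} (hβ : 0 ≤ β)
    (hδβ : δ ≤ β) {s t : Finset (Fin k)} (hts : t ⊆ s) (hs : s.card ≤ r)
    (h : prob (Mismatch S ρ lam s) ≤ β) : prob (Mismatch S ρ lam t) ≤ 6 ^ k * β := by
  suffices h : ∀ n, ∀ t ⊆ s, s.card = t.card + n → prob (Mismatch S ρ lam t) ≤ 6 ^ n * β by
    refine (h (s.card - t.card) t hts (by have := Finset.card_le_card hts; omega)).trans ?_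
    have : s.card ≤ k := by simpa using Finset.card_le_univ s
    gcongr
    · norm_num
    · omega
  intro n
  induction n with
  | zero =>
    intro t ht hc
    rw [Finset.eq_of_subset_of_card_le ht (by omega)]
    simpa using h
  | succ n ih =>
    intro t ht hc
    obtain ⟨i, his, hit⟩ := Finset.exists_mem_notMem_of_card_lt_card (by omega : t.card < s.card)
    have hins : insert i t ⊆ s := Finset.insert_subset his ht
    have h1 := ih (insert i t) hins (by rw [Finset.card_insert_of_notMem hit]; omega)
    have h2 := hρ.prob_mismatch_le_insert hS hε lam hit ((Finset.card_le_card hins).trans hs)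
    have h3 : β ≤ 6 ^ n * β := le_mul_of_one_le_left hβ (one_le_pow₀ (by norm_num))
    rw [pow_succ]
    linarith

end GenCocycle

/-! ### One potential for all faces -/

section Global

variable {k : ℕ} {H : Type*} [AddCommGroup H] [Fintype H] {d r : ℕ} {ε δ : ℝ}
  {S : Set (DCube k → H)} {ρ : (DCube k → H) → DCube k → (Fin d → ℤ)}

/-- A real-valued function whose `k`-th derivative vanishes on almost all cubes of `S` takes a
fixed value at all vertices of almost all cubes of `S`. -/
theorem IsPopular.exists_eq_const (hS : IsPopular S ε) (hSne : S.Nonempty) (hSc : S ⊆ cubes k H)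
    (hk : 0 < k) (hε0 : 0 ≤ ε) (hε : 64 * (2 ^ k) ^ 4 * ε ≤ 1) (g : H → Fin d → ℝ) {β : ℝ}
    (hβ0 : 0 ≤ β) (hβ : 8 * (2 ^ k) ^ 2 * β ≤ 1)
    (hg : prob (fun z : H × (Fin k → H) => cube z.1 z.2 ∈ S ∧
      altSum Finset.univ (fun ω => g (z.1 + dot ω z.2)) ≠ 0) ≤ β) :
    ∃ b, prob (fun z : H × (Fin k → H) => cube z.1 z.2 ∈ S ∧
      ∃ ω ∈ (Finset.univ : Finset (Fin k)).powerset, g (z.1 + dot ω z.2) ≠ b) ≤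
        2 ^ k * (2 * β) := by
  have hpc := hS.isPartialCocycle_zero hε0
  have hne : ∃ x h, cube x h ∈ S := by
    obtain ⟨c, hc⟩ := hSne
    obtain ⟨x, h, rfl⟩ := hSc hc
    exact ⟨x, h, hc⟩
  have hJ : (Finset.univ : Finset (Fin k)).Nonempty := ⟨⟨0, hk⟩, Finset.mem_univ _⟩
  have hD : (1 : ℝ) ≤ 2 ^ k := one_le_pow₀ (by norm_num)
  have hmem := hpc.prob_not_mem_le (by positivity) le_rfl hJ hne
  have hvert : ∀ x h, cube x h ∈ S → ∀ ω : Finset (Fin k),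
      prob (fun h' => ¬ cube (x + dot ω h) h' ∈ S) ≤ 2 ^ k * (2 * ε) := fun x h hc ω => by
    have := hpc.dense_at_vertices (by positivity) le_rfl hc (Finset.subset_univ ω)
    rwa [Fintype.card_fin] at this
  rw [Fintype.card_fin] at hmem
  set D : ℝ := 2 ^ k with hDdef
  have hDε : 64 * (D * ε) ≤ 1 := by
    have : D * ε ≤ D ^ 4 * ε := by
      have : D ≤ D ^ 4 := le_self_pow₀ hD (by norm_num)
      gcongr
    linarith
  have hD3ε : 64 * (D ^ 3 * ε) ≤ 1 := by
    have : D ^ 3 * ε ≤ D ^ 4 * ε := by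
      have : D ^ 3 ≤ D ^ 4 := pow_le_pow_right₀ hD (by norm_num)
      gcongr
    linarith
  have hγ : prob (fun z : H × (Fin k → H) =>
      altSum Finset.univ (fun ω => g (z.1 + dot ω z.2)) ≠ 0) ≤ 4 * (D * ε) + β := by
    refine (prob_mono fun z hz => ?_).trans ((prob_or_le _ _).trans
      ((add_le_add hmem hg).trans (by linarith)))
    by_cases hc : cube z.1 z.2 ∈ S
    · exact Or.inr ⟨hc, hz⟩
    · exact Or.inl hc
  obtain ⟨b, hb⟩ := exists_eq_const_of_prob_altSum_ne_zero g (by positivity)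
    (by rw [Fintype.card_fin, ← hDdef]; nlinarith) hγ
  refine ⟨b, ?_⟩
  -- At the vertices of cubes of `S`, most cubes lie in `S`, so an exceptional vertex accounts for
  -- many exceptional cubes of `S`.
  have h1 : prob (fun x => 1 / 2 ≤ prob (fun h : Fin k → H => cube x h ∈ S ∧
      altSum Finset.univ (fun ω => g (x + dot ω h)) ≠ 0)) ≤ 2 * β := by
    have := mul_prob_section_le (fun z : H × (Fin k → H) => cube z.1 z.2 ∈ S ∧
      altSum Finset.univ (fun ω => g (z.1 + dot ω z.2)) ≠ 0) (1 / 2)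
    linarith
  refine (prob_mono ?_).trans ((prob_exists_subset_le Finset.univ
    (fun ω (z : H × (Fin k → H)) => 1 / 2 ≤ prob (fun h : Fin k → H =>
      cube (z.1 + dot ω z.2) h ∈ S ∧
      altSum Finset.univ (fun η => g (z.1 + dot ω z.2 + dot η h)) ≠ 0)) (c := 2 * β)
      (fun ω _ => ?_) (by positivity)).trans_eq (by rw [Fintype.card_fin]))
  · rintro ⟨x, h⟩ ⟨hc, ω, hω, hne⟩
    refine ⟨ω, hω, ?_⟩
    by_contra hcon
    refine hne (hb _ ?_)
    refine lt_of_le_of_lt ((prob_mono (q := fun h' => (¬ cube (x + dot ω h) h' ∈ S) ∨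
      (cube (x + dot ω h) h' ∈ S ∧
        altSum Finset.univ (fun η => g (x + dot ω h + dot η h')) ≠ 0)) fun h' hh' => ?_).trans
      (prob_or_le _ _)) ?_
    · by_cases hc' : cube (x + dot ω h) h' ∈ S
      · exact Or.inr ⟨hc', hh'⟩
      · exact Or.inl hc'
    · have h2 := hvert x h hc ω
      have h3 := not_le.1 hcon
      linarith
  · exact (prob_vertex ω (fun x => 1 / 2 ≤ prob (fun h : Fin k → H => cube x h ∈ S ∧
      altSum Finset.univ (fun ω => g (x + dot ω h)) ≠ 0))).trans_le h1

/-- Potentials for two sets of size `r` differ essentially by a constant, since the derivatives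
of either determine those over the empty set. So one potential serves all sets. -/
theorem IsGenCocycle.prob_mismatch_le_of_potentials (hρ : IsGenCocycle r δ S ρ)
    (hS : IsPopular S ε) (hSne : S.Nonempty) (hSc : S ⊆ cubes k H) (hr : r < k)
    (hε0 : 0 ≤ ε) (hε : 64 * (2 ^ k) ^ 4 * ε ≤ 1) {β : ℝ} (hβ0 : 0 ≤ β)
    (hβ : 16 * (2 ^ k) ^ 2 * (6 ^ k * β) ≤ 1) (hδβ : δ ≤ β) {s₀ s : Finset (Fin k)}
    (hs₀ : s₀.card = r) (hs : s.card = r) {lam₀ lam : H → Fin d → ℝ}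
    (h₀ : prob (Mismatch S ρ lam₀ s₀) ≤ β) (h : prob (Mismatch S ρ lam s) ≤ β) :
    prob (Mismatch S ρ lam₀ s) ≤ 5 * 2 ^ k * 6 ^ k * β := by
  have hD : (1 : ℝ) ≤ 2 ^ k := one_le_pow₀ (by norm_num)
  have hD4 : (1 : ℝ) ≤ (2 ^ k) ^ 4 := one_le_pow₀ hD
  have hε4 : 4 * ε ≤ 1 := by nlinarith
  have h1 := hρ.prob_mismatch_le_of_subset hS hε4 lam₀ hβ0 hδβ (Finset.empty_subset s₀) hs₀.le h₀
  have h2 := hρ.prob_mismatch_le_of_subset hS hε4 lam hβ0 hδβ (Finset.empty_subset s) hs.le h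
  have hder : ∀ (f : H → Fin d → ℝ) (x : H) (h : Fin k → H),
      upDeriv (fun ω => f (cube x h ω)) ∅ = altSum Finset.univ (fun ω => f (x + dot ω h)) := by
    intro f x h
    simp [upDeriv_comp_cube, dot_empty]
  obtain ⟨b, hb⟩ := hS.exists_eq_const hSne hSc (by omega) hε0 hε (fun x => lam₀ x - lam x)
    (β := 2 * (6 ^ k * β)) (by positivity) (by linarith) (by
      rw [two_mul]
      refine (prob_mono ?_).trans ((prob_or_le _ _).trans (add_le_add h1 h2))
      rintro ⟨x, h⟩ ⟨hc, hne⟩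
      by_contra hcon
      simp only [Mismatch, not_or, not_and, not_not, ne_eq] at hcon
      refine hne ?_
      simp only
      rw [altSum_sub, ← hder, ← hder, hcon.1 hc, hcon.2 hc, sub_self])
  refine (prob_mono ?_).trans ((prob_or_le _ _).trans ((add_le_add h hb).trans ?_))
  · rintro ⟨x, h⟩ ⟨hc, hne⟩
    by_contra hcon
    simp only [Mismatch, not_or, not_and, not_not, ne_eq, not_exists, Finset.mem_powerset] at hcon
    refine hne ?_
    change upDeriv (fun ω => lam₀ (cube x h ω)) s = _
    rw [← hcon.1 hc, ← sub_eq_zero]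
    unfold upDeriv
    rw [← altSum_sub]
    have hne' : (sᶜ).Nonempty := by
      rw [← Finset.card_pos, Finset.card_compl, Fintype.card_fin]; omega
    rw [← altSum_const hne' b]
    refine altSum_congr fun t _ => ?_
    change lam₀ (cube x h (ind (s ∪ t))) - lam (cube x h (ind (s ∪ t))) = b
    rw [cube_ind]
    exact hcon.2 hc _ (Finset.subset_univ _)
  · have h3 : β ≤ 2 ^ k * (6 ^ k * β) := by
      have h6 : (1 : ℝ) ≤ 6 ^ k := one_le_pow₀ (by norm_num)
      calc β = 1 * (1 * β) := by ring
        _ ≤ 2 ^ k * (6 ^ k * β) := by gcongr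
    linarith

/-- For small `ε` and `δ`, a potential that is correct on almost all cubes of `S`, over all sets of
size at most `r`. -/
theorem IsGenCocycle.exists_global_potential (hρ : IsGenCocycle r δ S ρ) (hS : IsPopular S ε)
    (hSne : S.Nonempty) (hSc : S ⊆ cubes k H) (hε0 : 0 ≤ ε) (hδ0 : 0 ≤ δ) (hr : r < k)
    (hε : 64 * (2 ^ k) ^ 4 * ε ≤ 1) (hδ : 192 * 36 ^ k * (2 ^ k) ^ 6 * δ ≤ 1)
    {R : ℝ} (hR0 : 0 ≤ R) (hR : ∀ c ∈ S, ∀ ω, ∑ j, |(ρ c ω j : ℝ)| ≤ R) :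
    ∃ (lam : H → Fin d → ℝ) (J : Finset (Fin k)), J.card = k - r ∧
      (∀ x a, ∃ z : Fin d → ℤ, altSum J (fun ω => lam (x + dot ω a)) = fun j => (z j : ℝ)) ∧
      (∀ x, ∑ j, |lam x j| ≤ 2 * (2 ^ k) ^ 2 * R) ∧
      prob (fun z : H × (Fin k → H) => ∃ s ∈ (Finset.univ : Finset (Fin k)).powerset,
        s.card ≤ r ∧ Mismatch S ρ lam s z) ≤ 60 * 36 ^ k * (2 ^ k) ^ 6 * δ := by
  have hD : (1 : ℝ) ≤ 2 ^ k := one_le_pow₀ (by norm_num)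
  have h6 : (1 : ℝ) ≤ 6 ^ k := one_le_pow₀ (by norm_num)
  have h36 : (36 : ℝ) ^ k = 6 ^ k * 6 ^ k := by rw [← mul_pow]; norm_num
  have hε4 : 4 * ε ≤ 1 := by nlinarith [one_le_pow₀ hD (n := 4)]
  have hδ6 : 192 * 6 ^ k * (2 ^ k) ^ 6 * δ ≤ 1 := by
    refine le_trans ?_ hδ
    have : (6 : ℝ) ^ k ≤ 36 ^ k := by gcongr; norm_num
    gcongr
  have hδ8 : 8 * (2 ^ k) ^ 4 * δ ≤ 1 := by
    refine le_trans ?_ hδ6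
    have : (8 : ℝ) * (2 ^ k) ^ 4 ≤ 192 * 6 ^ k * (2 ^ k) ^ 6 := by
      calc (8 : ℝ) * (2 ^ k) ^ 4 ≤ (192 * 6 ^ k) * (2 ^ k) ^ 6 := by
            gcongr
            · linarith
            · norm_num
        _ = _ := by ring
    gcongr
  have key := fun s (hs : s.card = r) =>
    hρ.exists_potential hS hSne hSc hε0 hδ0 hr hε hδ8 hR0 hR (s := s) hs
  obtain ⟨s₀, -, hs₀⟩ := Finset.exists_superset_card_eq (s := (∅ : Finset (Fin k))) (n := r)
    (by simp) (by rw [Fintype.card_fin]; exact hr.le)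
  obtain ⟨lam₀, hint, hbound, hmis⟩ := key s₀ hs₀
  set β : ℝ := 12 * (2 ^ k) ^ 4 * δ with hβdef
  have hβ0 : 0 ≤ β := by positivity
  have hδβ : δ ≤ β := by
    have : (1 : ℝ) ≤ (2 ^ k) ^ 4 := one_le_pow₀ hD
    rw [hβdef]
    nlinarith
  have hall : ∀ s : Finset (Fin k), s.card = r →
      prob (Mismatch S ρ lam₀ s) ≤ 5 * 2 ^ k * 6 ^ k * β := by
    intro s hs
    obtain ⟨lam, -, -, hmis'⟩ := key s hs
    refine hρ.prob_mismatch_le_of_potentials hS hSne hSc hr hε0 hε hβ0 ?_ hδβ hs₀ hs hmis hmis'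
    refine le_trans (le_of_eq ?_) hδ6
    rw [hβdef]; ring
  have hβ5 : β ≤ 5 * 2 ^ k * 6 ^ k * β := by
    calc β = 1 * 1 * 1 * β := by ring
      _ ≤ 5 * 2 ^ k * 6 ^ k * β := by gcongr; norm_num
  refine ⟨lam₀, s₀ᶜ, by rw [Finset.card_compl, Fintype.card_fin, hs₀], hint, hbound, ?_⟩
  refine (prob_exists_subset_le Finset.univ (fun s z => s.card ≤ r ∧ Mismatch S ρ lam₀ s z)
    (c := 6 ^ k * (5 * 2 ^ k * 6 ^ k * β)) (fun t _ => ?_) (by positivity)).trans_eq ?_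
  · by_cases ht : t.card ≤ r
    · obtain ⟨s, hts, hs⟩ := Finset.exists_superset_card_eq ht
        (by rw [Fintype.card_fin]; exact hr.le)
      simp only [ht, true_and]
      exact hρ.prob_mismatch_le_of_subset hS hε4 lam₀ (by positivity) (hδβ.trans hβ5) hts hs.le
        (hall s hs)
    · simp only [ht, false_and, prob_false]
      positivity
  · rw [Fintype.card_fin, h36, hβdef]
    ring

end Global

/-- Integrality of the derivatives is the vanishing of the derivatives modulo `1`. -/
theorem altSum_coe_eq_zero_iff {ι : Type*} {d : ℕ} (J : Finset ι) (f : Finset ι → Fin d → ℝ) :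
    altSum J (fun t => fun j => (f t j : UnitAddCircle)) = 0 ↔
      ∃ z : Fin d → ℤ, altSum J f = fun j => (z j : ℝ) := by
  let φ : (Fin d → ℝ) →+ (Fin d → UnitAddCircle) :=
    (QuotientAddGroup.mk' (AddSubgroup.zmultiples (1 : ℝ))).compLeft (Fin d)
  have h1 : altSum J (fun t => fun j => (f t j : UnitAddCircle)) = φ (altSum J f) :=
    (altSum_map J f φ).symm
  rw [h1]
  constructor
  · intro h
    have h2 : ∀ j, ∃ n : ℤ, n • (1 : ℝ) = altSum J f j := fun j =>
      (AddCircle.coe_eq_zero_iff (1 : ℝ)).1 (congrFun h j)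
    choose z hz using h2
    exact ⟨z, funext fun j => by rw [← hz j]; simp⟩
  · rintro ⟨z, hz⟩
    rw [hz]
    funext j
    exact (AddCircle.coe_eq_zero_iff (1 : ℝ)).2 ⟨z j, by simp⟩

theorem ncard_cubes (k : ℕ) (H : Type*) [AddCommGroup H] [Fintype H] :
    (cubes k H).ncard = Fintype.card (H × (Fin k → H)) := by
  have h1 : cubes k H = Set.range fun z : H × (Fin k → H) => cube z.1 z.2 := by
    ext c
    constructor
    · rintro ⟨x, h, rfl⟩
      exact ⟨(x, h), rfl⟩
    · rintro ⟨z, rfl⟩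
      exact ⟨z.1, z.2, rfl⟩
  rw [h1, ← Set.image_univ, Set.ncard_image_of_injective, Set.ncard_univ,
    Nat.card_eq_fintype_card]
  rintro ⟨x, h⟩ ⟨x', h'⟩ heq
  obtain ⟨h1, h2⟩ := cube_injective heq
  exact Prod.ext h1 h2

/-- The number of cubes in `S` with a property is bounded by the probability of the property. -/
theorem ncard_sep_le_prob_mul {k : ℕ} {H : Type*} [AddCommGroup H] [Fintype H]
    {S : Set (DCube k → H)} (hS : S ⊆ cubes k H) (p : (DCube k → H) → Prop) :
    (({c ∈ S | p c}.ncard : ℕ) : ℝ) ≤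
      prob (fun z : H × (Fin k → H) => cube z.1 z.2 ∈ S ∧ p (cube z.1 z.2)) *
        ((cubes k H).ncard : ℝ) := by
  rw [ncard_cubes, ← ncard_eq_prob_mul, Nat.cast_le]
  refine (Set.ncard_le_ncard ?_ (Set.toFinite _)).trans
    (Set.ncard_image_le (f := fun z : H × (Fin k → H) => cube z.1 z.2) (Set.toFinite _))
  rintro c ⟨hc, hp⟩
  obtain ⟨x, h, rfl⟩ := hS hc
  exact ⟨(x, h), ⟨hc, hp⟩, rfl⟩

end CubeSystems

theorem lemma3p5 (k : ℕ) :
    ∃ ε₀ A B K : ℝ, 0 < ε₀ ∧ 0 < A ∧ 0 < B ∧ 0 < K ∧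
      ∀ (H : Type*) [AddCommGroup H] [Finite H] (d r : ℕ), r < k →
      ∀ (ε δ : ℝ), ε ≤ ε₀ → 0 < δ →
      ∀ (S : (j : ℕ) → Set (DCube j → H)), IsCubeSystem k (1 - ε) S →
      ∀ (ρ : (DCube k → H) → DCube k → (Fin d → ℤ)), IsGenCocycle r δ (S k) ρ →
      ∃ lam : H → (Fin d → ℝ),
        -- the normal form of `ω ↦ lam (c ω)` is `ρ c` for almost all `c ∈ S k`
        (({c ∈ S k | ¬ ∀ ω : DCube k,
            normalForm r (fun ω' => lam (c ω')) ω = fun j => (ρ c ω j : ℝ)}.ncard : ℕ) : ℝ)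
          ≤ A * δ ^ (1 / B) * ((cubes k H).ncard : ℝ) ∧
        -- the derivatives of order `k - r` are integral
        (∀ c ∈ cubes (k - r) H, ∃ z : Fin d → ℤ, cubeDeriv lam c = fun j => (z j : ℝ)) ∧
        -- `lam mod ℤ^d` is a polynomial map of degree `k - r - 1`
        IsPolyMap (k - r - 1) (fun (x : H) (j : Fin d) => (lam x j : UnitAddCircle)) ∧
        -- the bound for the `ℓ¹` norm
        (∀ x : H, ∑ j, |lam x j| ≤
          K * ((⨆ c : S k, ∑ ω : DCube k, ∑ j, |(ρ c ω j : ℝ)|) + d)) := by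
  classical
  refine ⟨1 / (64 * (2 ^ k) ^ 4), 192 * 36 ^ k * (2 ^ k) ^ 6, 1, 2 * (2 ^ k) ^ 2,
    by positivity, by positivity, by norm_num, by positivity, ?_⟩
  intro H _ _ d r hr ε δ hε hδ S hS ρ hρ
  have := Fintype.ofFinite H
  rw [div_one, Real.rpow_one]
  set ε₀ : ℝ := 1 / (64 * (2 ^ k) ^ 4) with hε₀
  have hSc : S k ⊆ cubes k H := hS.subset_cubes k le_rfl
  -- It suffices to find a function whose derivatives in some `k - r` coordinates are integral.
  suffices hmain : ∃ (lam : H → Fin d → ℝ) (J : Finset (Fin k)), J.card = k - r ∧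
      (∀ x a, ∃ z : Fin d → ℤ, altSum J (fun ω => lam (x + dot ω a)) = fun j => (z j : ℝ)) ∧
      (∀ x, ∑ j, |lam x j| ≤
        2 * (2 ^ k) ^ 2 * (⨆ c : S k, ∑ ω : DCube k, ∑ j, |(ρ c ω j : ℝ)|)) ∧
      prob (fun z : H × (Fin k → H) => cube z.1 z.2 ∈ S k ∧ ¬ ∀ ω : DCube k,
        normalForm r (fun ω' => lam (cube z.1 z.2 ω')) ω = fun j => (ρ (cube z.1 z.2) ω j : ℝ)) ≤
          192 * 36 ^ k * (2 ^ k) ^ 6 * δ by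
    obtain ⟨lam, J, hJ, hint, hbound, hprob⟩ := hmain
    have hcirc : ∀ x (a : Fin k → H),
        altSum J (fun t => fun j => (lam (x + dot t a) j : UnitAddCircle)) = 0 :=
      fun x a => (altSum_coe_eq_zero_iff J _).2 (hint x a)
    refine ⟨lam, ?_, ?_, ?_, fun x => (hbound x).trans ?_⟩
    · refine (ncard_sep_le_prob_mul hSc _).trans ?_
      gcongr
    · rintro c ⟨x, a, rfl⟩
      rw [cubeDeriv_eq_altSum]
      refine (altSum_coe_eq_zero_iff _ _).1 ?_
      exact altSum_vertices_eq_zero_of_card_eq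
        (p := fun (x : H) (j : Fin d) => (lam x j : UnitAddCircle)) (by simpa using hJ) hcirc x a
    · exact isPolyMap_of_altSum_eq_zero
        (p := fun (x : H) (j : Fin d) => (lam x j : UnitAddCircle)) (by omega) hcirc
    · have : (0 : ℝ) ≤ d := by positivity
      gcongr
      linarith
  have hR0 : 0 ≤ ⨆ c : S k, ∑ ω : DCube k, ∑ j, |(ρ c ω j : ℝ)| :=
    Real.iSup_nonneg fun c => by positivity
  by_cases htriv : S k = ∅ ∨ 1 < 192 * 36 ^ k * (2 ^ k) ^ 6 * δ
  · -- There is no cube to get right, or the bound exceeds the number of all cubes.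
    obtain ⟨J, -, hJ⟩ := Finset.exists_superset_card_eq (s := (∅ : Finset (Fin k))) (n := k - r)
      (by simp) (by rw [Fintype.card_fin]; omega)
    refine ⟨0, J, hJ, fun x a => ⟨0, ?_⟩, fun x => ?_, ?_⟩
    · funext j
      simp [altSum]
    · simpa using by positivity
    · rcases htriv with h | h
      · simp only [h, Set.mem_empty_iff_false, false_and, prob_false]
        positivity
      · refine le_trans ?_ h.le
        have h1 := prob_nonneg (fun z : H × (Fin k → H) => ¬ (cube z.1 z.2 ∈ S k ∧
          ¬ ∀ ω : DCube k, normalForm r (fun ω' => (0 : H → Fin d → ℝ) (cube z.1 z.2 ω')) ω =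
            fun j => (ρ (cube z.1 z.2) ω j : ℝ)))
        rw [prob_not] at h1
        linarith
  · push Not at htriv
    have hpop : IsPopular (S k) ε₀ := by
      have h1 := hS.isPopular
      exact ⟨fun x h i hc => (h1.popular x h i hc).trans hε, h1.reflect⟩
    have hRle : ∀ c ∈ S k, ∀ ω, ∑ j, |(ρ c ω j : ℝ)| ≤
        ⨆ c : S k, ∑ ω : DCube k, ∑ j, |(ρ c ω j : ℝ)| := by
      intro c hc ω
      refine le_trans ?_ (le_ciSup (f := fun c : S k => ∑ ω : DCube k, ∑ j, |(ρ c ω j : ℝ)|)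
        (Set.finite_range _).bddAbove ⟨c, hc⟩)
      exact Finset.single_le_sum (f := fun ω => ∑ j, |(ρ c ω j : ℝ)|)
        (fun ω _ => by positivity) (Finset.mem_univ ω)
    obtain ⟨lam, J, hJ, hint, hbound, hprob⟩ := hρ.exists_global_potential hpop htriv.1 hSc
      (by positivity) hδ.le hr (by rw [hε₀]; field_simp; exact le_rfl) htriv.2 hR0 hRle
    refine ⟨lam, J, hJ, hint, hbound, (prob_mono ?_).trans (hprob.trans ?_)⟩
    · rintro ⟨x, h⟩ ⟨hc, hne⟩
      by_contra hcon
      simp only [not_exists, not_and, Finset.mem_powerset, Mismatch, not_not, ne_eq] at hcon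
      refine hne ?_
      have h1 : normalForm r (fun ω => lam (cube x h ω)) =
          normalForm r (fun ω => fun j => (ρ (cube x h) ω j : ℝ)) := by
        refine normalForm_congr fun u hu => ?_
        rw [hcon u (Finset.subset_univ u) hu hc]
        exact (upDeriv_map ((Int.castAddHom ℝ).compLeft (Fin d)) (ρ (cube x h)) u).symm
      intro ω
      change normalForm r (fun ω => lam (cube x h ω)) ω = _
      rw [h1, normalForm_eq_self]
      intro ω hω
      rw [hρ.normal _ hc ω hω]
      funext j
      simp
    · gcongr
      norm_num
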